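/- Let $A=\begin{pmatrix}E&F\\F&G\end{pmatrix}$ be a complex symmetric $2\times2$ matrix such that $\operatorname{Re}(A)$ and $\operatorname{Re}(A^{-1})$ are positive definite, and let $Q_A(v)=v^TAv=Ev_1^2+2Fv_1v_2+Gv_2^2$ for $v\in\mathbb R^2$. Powers of $Q_A$ are principal powers. For $\operatorname{Re}(s)>1$ the Epstein zeta function of $Q_A$ is $$Z_A(s)=\sum_{j\in\mathbb Z^2\setminus\{0\}}Q_A(j)^{-s};$$ the series converges absolutely there, and $Z_A$ extends (uniquely) to a holomorphic function on $\mathbb C\setminus\{1\}$, again denoted $Z_A$. Let $g:\mathbb R^2\to\mathbb C$ be smooth and compactly supported and let $s\in\mathbb R$, $s<1$. Then $g/Q_A^s$ is integrable on $\mathbb R^2$, and with $$I=\int_{\mathbb R^2}\frac{g(v)}{Q_A(v)^s}\,dv,\qquad T_h=\sum_{j\in\mathbb Z^2\setminus\{0\}}\frac{g(jh)}{Q_A(j)^s}\,h^{2-2s}\quad(h>0)$$ one has $$\bigl|\,I-\bigl(T_h-Z_A(s)\,g(0)\,h^{2-2s}\bigr)\bigr|=O(h^{4-2s})\qquad\text{as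 }h\to0^+,$$ where the implied constant may depend on $A$, $g$ and $s$. -/

import Mathlib

open Filter Topology Asymptotics MeasureTheory
open scoped Matrix ContDiff

/-- The complex quadratic form `Q_A(v) = vᵀ A v` evaluated at a real vector `v ∈ ℝ²`. -/
noncomputable def quadForm (A : Matrix (Fin 2) (Fin 2) ℂ) (v : Fin 2 → ℝ) : ℂ :=
  (fun i => (v i : ℂ)) ⬝ᵥ (A *ᵥ fun i => (v i : ℂ))

/-- A lattice point `j ∈ ℤ²`, regarded as a vector of `ℝ²`. -/
def latticePt (j : Fin 2 → ℤ) : Fin 2 → ℝ := fun i => (j i : ℝ)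

/-- The integral `I = ∫_{ℝ²} g(v) / Q_A(v)^s dv`. The power is the principal one
(when `Re A` is positive definite, `Q_A(v)` lies in the right half plane for `v ≠ 0`). -/
noncomputable def singularIntegral (A : Matrix (Fin 2) (Fin 2) ℂ) (g : (Fin 2 → ℝ) → ℂ)
    (s : ℝ) : ℂ :=
  ∫ v : Fin 2 → ℝ, g v / quadForm A v ^ (s : ℂ)

/-- The punctured trapezoidal rule
`T_h = ∑_{j ∈ ℤ², j ≠ 0} g(j h) / Q_A(j)^s * h^(2 - 2 s)`.
For compactly supported `g` and `h > 0` only finitely many terms are nonzero. -/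
noncomputable def puncturedTrapezoidal (A : Matrix (Fin 2) (Fin 2) ℂ) (g : (Fin 2 → ℝ) → ℂ)
    (s h : ℝ) : ℂ :=
  ∑' j : {j : Fin 2 → ℤ // j ≠ 0},
    g (h • latticePt j) / quadForm A (latticePt j) ^ (s : ℂ) * ((h ^ (2 - 2 * s) : ℝ) : ℂ)

/-- `Z` is an analytic continuation to `ℂ \ {1}` of the Epstein zeta function
`∑_{j ∈ ℤ², j ≠ 0} Q_A(j)^(-s)`, `Re s > 1`. The value `Z 1` is irrelevant. -/
def IsEpsteinContinuation (A : Matrix (Fin 2) (Fin 2) ℂ) (Z : ℂ → ℂ) : Prop :=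
  DifferentiableOn ℂ Z {1}ᶜ ∧
    ∀ s : ℂ, 1 < s.re →
      HasSum (fun j : {j : Fin 2 → ℤ // j ≠ 0} => quadForm A (latticePt j) ^ (-s)) (Z s)

open Classical in
/-- The analytically continued Epstein zeta function `Z_A` of the form `Q_A`
(and `0` for those `A` for which there is no continuation). -/
noncomputable def epsteinZeta (A : Matrix (Fin 2) (Fin 2) ℂ) : ℂ → ℂ :=
  if h : ∃ Z, IsEpsteinContinuation A Z then Classical.choose h else 0

/-- The analytic continuation is unique on `ℂ \ {1}`. -/
theorem IsEpsteinContinuation.eqOn {A : Matrix (Fin 2) (Fin 2) ℂ} {Z W : ℂ → ℂ}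
    (hZ : IsEpsteinContinuation A Z) (hW : IsEpsteinContinuation A W) :
    Set.EqOn Z W {1}ᶜ := by
  have hpre : IsPreconnected ({1}ᶜ : Set ℂ) :=
    (isConnected_compl_singleton_of_one_lt_rank (by simp [Complex.rank_real_complex]) 1).isPreconnected
  have h2 : (2 : ℂ) ∈ ({1}ᶜ : Set ℂ) := by simp
  refine (hZ.1.analyticOnNhd isOpen_compl_singleton).eqOn_of_preconnected_of_eventuallyEq
    (hW.1.analyticOnNhd isOpen_compl_singleton) hpre h2 ?_
  have hopen : IsOpen {s : ℂ | 1 < s.re} := isOpen_lt continuous_const Complex.continuous_re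
  filter_upwards [hopen.mem_nhds (show (1 : ℝ) < (2 : ℂ).re by norm_num)] with s hs
  exact (hZ.2 s hs).unique (hW.2 s hs)

/-- Any analytic continuation agrees with `epsteinZeta A` on `ℂ \ {1}`. -/
theorem IsEpsteinContinuation.epsteinZeta_eq {A : Matrix (Fin 2) (Fin 2) ℂ} {Z : ℂ → ℂ}
    (hZ : IsEpsteinContinuation A Z) {s : ℂ} (hs : s ≠ 1) : epsteinZeta A s = Z s := by
  have h : ∃ Z, IsEpsteinContinuation A Z := ⟨Z, hZ⟩
  have hc : IsEpsteinContinuation A (epsteinZeta A) := by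
    rw [epsteinZeta, dif_pos h]
    exact Classical.choose_spec h
  exact hc.eqOn hZ hs

/-! Write χ for `latticeBump`, ψ_b(v) = χ(v/b) − χ(v) for `annularCutoff b`, and E(F, H) for
`trapezoidError F H`. Rescaling by h turns T_h − I into h^(2−2s) times the punctured error, with
step 1, of G·Q^(−s), where G = g(h·) (`puncturedTrapezoidal_sub_singularIntegral`). It remains to
see that this error is Z_A(s)g(0) + O(h²).

The singularity is handled by dyadic annuli. Since ψ_(2^K)(v) is the sum of ψ_2(v/2^k) over k < K
and Q is homogeneous, E(ψ_(2^K) Q^(−s) G, 1) is the sum over k < K of 2^(k(2−2s)) E(ψ_2 Q^(−s)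
G(2^k·), 2^(−k)) (`trapezoidError_annularPower_two_pow`). Each term involves a smooth function
supported in a fixed ball, for which Poisson summation gives an error O(H^M) with M arbitrary
(`exists_norm_trapezoidError_le`); this beats the growth of 2^(k(2−2s)) for every s.

For G = 1 the full series is entire in s. Letting K → ∞ when Re s > 1 identifies it with Z_A(s) +
β(s), where β = `bumpIntegral` continues ∫ χ Q^(−s) (`isEpsteinContinuation_dyadicZeta`). For G =
g(h·) and s < 1 it equals the punctured error plus ∫ χ G Q^(−s)
(`hasSum_trapezoidError_annularPower_mul`).

Subtracting g(0) times the first series from the second replaces g by u = g − g(0). As Q is even, g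
may be symmetrized (`puncturedError_symmetrize`), so that u vanishes to second order at 0. Then the
k-th term gains a factor (h 2^k)², and ∫ χ u(h·) Q^(−s) is O(h²); β(s)g(0) cancels and the claim
follows. -/

/-! ### The trapezoidal rule for smooth compactly supported functions -/

open scoped FourierTransform in
/-- The error of the trapezoidal rule on the line, by Poisson summation. -/
theorem exists_norm_trapezoid_sub_integral_le (M : ℕ) (hM : 2 ≤ M) (R : ℝ) :
    ∃ C : ℝ, 0 ≤ C ∧ ∀ f : ℝ → ℂ, ContDiff ℝ ∞ f → (∀ x, R < |x| → f x = 0) →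
      ∀ B : ℝ, (∀ x, ‖iteratedDeriv M f x‖ ≤ B) → ∀ H : ℝ, 0 < H →
        ‖(H : ℂ) * ∑' n : ℤ, f (n * H) - ∫ x, f x‖ ≤ C * B * H ^ M := by
  have hS : Summable fun k : ℤ => ((2 * Real.pi * |(k : ℝ)|) ^ M)⁻¹ := by
    simp_rw [mul_pow, mul_inv]
    refine Summable.mul_left _ ?_
    have := (Real.summable_abs_int_rpow (b := M) (by exact_mod_cast hM))
    refine this.congr fun k => ?_
    rw [Real.rpow_neg (abs_nonneg _), Real.rpow_natCast]
  have hS0 : 0 ≤ ∑' k : ℤ, ((2 * Real.pi * |(k : ℝ)|) ^ M)⁻¹ :=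
    tsum_nonneg fun k => by positivity
  refine ⟨2 * |R| * ∑' k : ℤ, ((2 * Real.pi * |(k : ℝ)|) ^ M)⁻¹, by positivity, ?_⟩
  intro f hf hR B hB H hH
  have hB0 : 0 ≤ B := (norm_nonneg _).trans (hB 0)
  set fH : ℝ → ℂ := fun x => f (H * x) with hfH
  have hsm : ContDiff ℝ ∞ fH := hf.comp (contDiff_const.mul contDiff_id)
  have hout : ∀ x, |R| / H < |x| → fH x = 0 := by
    intro x hx
    apply hR
    rw [abs_mul, abs_of_pos hH]
    rw [div_lt_iff₀ hH] at hx
    linarith [le_abs_self R]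
  have hcs : HasCompactSupport fH := by
    refine HasCompactSupport.of_support_subset_isCompact (isCompact_Icc (a := -(|R| / H))
      (b := |R| / H)) fun x hx => ?_
    by_contra h
    exact hx (hout x (by simpa [Set.mem_Icc, ← abs_le] using h))
  have hint : ∀ n : ℕ, Integrable (iteratedDeriv n fH) := fun n => by
    have hn : Continuous (iteratedDeriv n fH) := hsm.continuous_iteratedDeriv n (by exact_mod_cast le_top)
    refine hn.integrable_of_hasCompactSupport ?_
    rw [iteratedDeriv_eq_equiv_comp]
    exact (hcs.iteratedFDeriv (𝕜 := ℝ) n).comp_left (map_zero _)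
  have hderiv : ∀ x, ‖iteratedDeriv M fH x‖ ≤ H ^ M * B := fun x => by
    have := iteratedDeriv_comp_const_smul (n := M) (f := f) (hf.of_le (by exact_mod_cast le_top)) H
    rw [hfH, congrFun this x, norm_smul, norm_pow, Real.norm_of_nonneg hH.le]
    gcongr
    exact hB _
  -- The rescaled support has length at most 2|R|/H; this 1/H is cancelled at the end by the step H
  -- in front of the sum.
  have hL1 : ∫ x, ‖iteratedDeriv M fH x‖ ≤ 2 * (|R| / H) * (H ^ M * B) := by
    have h0 : ∀ x, x ∉ Set.Icc (-(|R| / H)) (|R| / H) → ‖iteratedDeriv M fH x‖ = 0 := by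
      intro x hx
      rw [norm_eq_zero]
      by_contra h
      have h1 : x ∈ tsupport fH := by
        apply support_iteratedFDeriv_subset (𝕜 := ℝ) M
        rw [Function.mem_support]
        intro h2
        exact h (by rw [iteratedDeriv, h2]; rfl)
      have : tsupport fH ⊆ Set.Icc (-(|R| / H)) (|R| / H) := by
        refine closure_minimal (fun y hy => ?_) isClosed_Icc
        by_contra h'
        exact hy (hout y (by simpa [Set.mem_Icc, ← abs_le] using h'))
      exact hx (this h1)
    rw [← setIntegral_eq_integral_of_forall_compl_eq_zero h0]
    have := norm_setIntegral_le_of_norm_le_const (μ := volume)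
      (s := Set.Icc (-(|R| / H)) (|R| / H)) (f := fun x => ‖iteratedDeriv M fH x‖) (C := H ^ M * B)
      (by simp) (fun x _ => by simpa using hderiv x)
    refine (le_abs_self _).trans (this.trans ?_)
    rw [Real.volume_real_Icc_of_le (by linarith [show 0 ≤ |R| / H by positivity])]
    apply le_of_eq; ring
  -- Differentiating M times multiplies the transform by (2πik)^M, and a transform is bounded by the
  -- L¹ norm.
  have hF : ∀ k : ℤ, k ≠ 0 →
      ‖𝓕 fH k‖ ≤ 2 * (|R| / H) * (H ^ M * B) * ((2 * Real.pi * |(k : ℝ)|) ^ M)⁻¹ := by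
    intro k hk
    have h1 := congrFun (Real.fourier_iteratedDeriv (N := ⊤) (n := M) hsm (fun n _ => hint n) le_top) k
    have h2 : ‖𝓕 (iteratedDeriv M fH) (k : ℝ)‖ ≤ ∫ x, ‖iteratedDeriv M fH x‖ := by
      rw [Real.fourier_eq]
      exact (norm_integral_le_integral_norm _).trans_eq (by simp)
    rw [h1, norm_smul, norm_pow] at h2
    have h3 : ‖(2 * Real.pi * Complex.I * ((k : ℝ) : ℂ))‖ = 2 * Real.pi * |(k : ℝ)| := by
      simp [abs_of_pos Real.pi_pos]
    rw [h3] at h2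
    have hpos : 0 < (2 * Real.pi * |(k : ℝ)|) ^ M := by
      have : 0 < |(k : ℝ)| := by simpa using hk
      have := Real.pi_pos
      positivity
    rw [← div_eq_mul_inv, le_div_iff₀ hpos, mul_comm]
    exact h2.trans hL1
  have hsumF : Summable fun k : ℤ => 𝓕 fH k := by
    refine Summable.of_norm_bounded_eventually (hS.mul_left (2 * (|R| / H) * (H ^ M * B))) ?_
    filter_upwards [(Set.finite_singleton (0 : ℤ)).compl_mem_cofinite] with k hk using hF k hk
  have hP : ∑' n : ℤ, fH n = ∑' n : ℤ, 𝓕 fH n := by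
    have := (hcs.toSchwartzMap hsm).tsum_eq_tsum_fourier 0
    simp only [zero_add, QuotientAddGroup.mk_zero, fourier_eval_zero,
      mul_one] at this
    exact this
  have h0 : 𝓕 fH ((0 : ℤ) : ℝ) = (H : ℂ)⁻¹ * ∫ x, f x := by
    have := Measure.integral_comp_mul_left f H
    rw [Real.fourier_eq]
    simp only [Int.cast_zero, inner_zero_right, neg_zero, AddChar.map_zero_eq_one, one_smul]
    rw [hfH, this, abs_of_pos (inv_pos.2 hH)]
    simp
  rw [hsumF.tsum_eq_add_tsum_ite 0, h0] at hP
  have h1 : ∑' n : ℤ, f (n * H) = ∑' n : ℤ, fH n := by simp [hfH, mul_comm]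
  have hH' : (H : ℂ) ≠ 0 := by exact_mod_cast hH.ne'
  rw [h1, hP, mul_add, mul_inv_cancel_left₀ hH', add_sub_cancel_left, norm_mul]
  have h2 : ‖∑' n : ℤ, ite (n = 0) 0 (𝓕 fH n)‖ ≤
      2 * (|R| / H) * (H ^ M * B) * ∑' k : ℤ, ((2 * Real.pi * |(k : ℝ)|) ^ M)⁻¹ := by
    refine tsum_of_norm_bounded (hS.hasSum.mul_left _) fun k => ?_
    split_ifs with hk
    · rw [norm_zero]; positivity
    · exact hF k hk
  rw [Complex.norm_of_nonneg hH.le]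
  refine (mul_le_mul_of_nonneg_left h2 hH.le).trans_eq ?_
  field_simp

theorem norm_iteratedFDeriv_comp_affine_le {D E : Type*} [NormedAddCommGroup D] [NormedSpace ℝ D]
    [NormedAddCommGroup E] [NormedSpace ℝ E] {F : E → ℂ} (hF : ContDiff ℝ ∞ F) (M : ℕ) (a : E)
    (L : D →L[ℝ] E) (v : D) :
    ‖iteratedFDeriv ℝ M (fun v => F (a + L v)) v‖ ≤
      ‖iteratedFDeriv ℝ M F (a + L v)‖ * ‖L‖ ^ M := by
  have h1 : (fun v => F (a + L v)) = (fun v => F (a + v)) ∘ L := rfl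
  have h2 : ContDiff ℝ ∞ fun v => F (a + v) := hF.comp (contDiff_const.add contDiff_id)
  rw [h1, ContinuousLinearMap.iteratedFDeriv_comp_right _ h2 _ (by exact_mod_cast le_top)]
  refine (ContinuousMultilinearMap.norm_compContinuousLinearMap_le _ _).trans_eq ?_
  rw [iteratedFDeriv_comp_add_left, Finset.prod_const, Finset.card_univ, Fintype.card_fin]

theorem norm_iteratedDeriv_comp_line_le {E : Type*} [NormedAddCommGroup E] [NormedSpace ℝ E]
    {F : E → ℂ} (hF : ContDiff ℝ ∞ F) {M : ℕ} {B : ℝ} (hB : ∀ v, ‖iteratedFDeriv ℝ M F v‖ ≤ B)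
    (a e : E) (he : ‖e‖ ≤ 1) (t : ℝ) :
    ‖iteratedDeriv M (fun t : ℝ => F (a + t • e)) t‖ ≤ B := by
  rw [← norm_iteratedFDeriv_eq_norm_iteratedDeriv]
  refine (norm_iteratedFDeriv_comp_affine_le hF M a
    (ContinuousLinearMap.toSpanSingleton ℝ e) t).trans ?_
  rw [ContinuousLinearMap.norm_toSpanSingleton]
  exact (mul_le_of_le_one_right (norm_nonneg _) (pow_le_one₀ (norm_nonneg _) he)).trans (hB _)

/-- The error of the trapezoidal rule with step `H` on the lattice `H ℤ²`. -/
noncomputable def trapezoidError (F : (Fin 2 → ℝ) → ℂ) (H : ℝ) : ℂ :=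
  (H : ℂ) ^ 2 * ∑' j : Fin 2 → ℤ, F (H • latticePt j) - ∫ v, F v

theorem finite_setOf_norm_smul_latticePt_le {H : ℝ} (hH : 0 < H) (R : ℝ) :
    {j : Fin 2 → ℤ | ‖H • latticePt j‖ ≤ R}.Finite := by
  have : {j : Fin 2 → ℤ | ‖H • latticePt j‖ ≤ R} ⊆ Metric.closedBall 0 (R / H) := by
    intro j hj
    rw [Set.mem_ofPred_eq, norm_smul, Real.norm_of_nonneg hH.le] at hj
    rw [mem_closedBall_zero_iff, le_div_iff₀ hH, mul_comm]
    exact hj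
  exact (isCompact_closedBall _ _).finite_of_discrete.subset this

theorem support_smul_latticePt_finite {F : (Fin 2 → ℝ) → ℂ} {R : ℝ} (hR : ∀ v, R < ‖v‖ → F v = 0)
    {H : ℝ} (hH : 0 < H) : (Function.support fun j : Fin 2 → ℤ => F (H • latticePt j)).Finite := by
  refine (finite_setOf_norm_smul_latticePt_le hH R).subset fun j hj => ?_
  by_contra h
  exact hj (hR _ (not_le.1 h))

theorem hasCompactSupport_of_forall_norm_lt {E : Type*} [NormedAddCommGroup E] [ProperSpace E]
    {F : E → ℂ} {R : ℝ} (hR : ∀ v, R < ‖v‖ → F v = 0) : HasCompactSupport F := by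
  refine HasCompactSupport.of_support_subset_isCompact (isCompact_closedBall 0 R) fun x hx => ?_
  by_contra h
  exact hx (hR x (by simpa using h))

theorem integral_fin_two_eq_integral_integral {F : (Fin 2 → ℝ) → ℂ} (hF : Continuous F)
    (hc : HasCompactSupport F) :
    Integrable (fun y => ∫ x, F ![x, y]) ∧ ∫ v, F v = ∫ y, ∫ x, F ![x, y] := by
  have hmp := (volume_preserving_finTwoArrow ℝ).symm
  have h1 : ∀ p : ℝ × ℝ, (MeasurableEquiv.finTwoArrow (α := ℝ)).symm p = ![p.1, p.2] := by
    intro p; rfl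
  have hint : Integrable (fun p : ℝ × ℝ => F ![p.1, p.2]) := by
    have := (hmp.integrable_comp_emb (MeasurableEquiv.measurableEmbedding _)).2
      (hF.integrable_of_hasCompactSupport hc)
    exact this
  refine ⟨hint.integral_prod_right, ?_⟩
  rw [← hmp.integral_comp', ← integral_prod_symm _ hint]
  rfl

/-- The one-dimensional rule is applied first in x on every horizontal slice, then in y on every
vertical line of the lattice. The constant depends on M and R only, which later makes the bound
uniform over the annuli. -/
theorem exists_norm_trapezoidError_le (M : ℕ) (hM : 2 ≤ M) (R : ℝ) :
    ∃ C : ℝ, 0 ≤ C ∧ ∀ F : (Fin 2 → ℝ) → ℂ, ContDiff ℝ ∞ F → (∀ v, R < ‖v‖ → F v = 0) →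
      ∀ B : ℝ, (∀ v, ‖iteratedFDeriv ℝ M F v‖ ≤ B) → ∀ H : ℝ, 0 < H → H ≤ 1 →
        ‖trapezoidError F H‖ ≤ C * B * H ^ M := by
  obtain ⟨C, hC0, hC⟩ := exists_norm_trapezoid_sub_integral_le M hM R
  -- 2|R| + 3 bounds H times the number of lattice lines that meet the support (this uses H ≤ 1);
  -- the other 2|R| is the length of the y-interval over which the x-error is integrated.
  refine ⟨C * (4 * |R| + 3), by positivity, fun F hF hR B hB H hH hH1 => ?_⟩
  have hB0 := (norm_nonneg _).trans (hB 0)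
  have hcs := hasCompactSupport_of_forall_norm_lt hR
  have hRx : ∀ x y, R < |x| → F ![x, y] = 0 := fun x y h =>
    hR _ (h.trans_le (norm_le_pi_norm ![x, y] 0))
  have hRy : ∀ x y, R < |y| → F ![x, y] = 0 := fun x y h =>
    hR _ (h.trans_le (norm_le_pi_norm ![x, y] 1))
  have hvec : ContDiff ℝ ∞ fun p : ℝ × ℝ => F ![p.1, p.2] := by
    refine hF.comp (contDiff_pi.2 fun i => ?_)
    fin_cases i
    · exact contDiff_fst
    · exact contDiff_snd
  have hx : ∀ y, ‖(H : ℂ) * ∑' m : ℤ, F ![m * H, y] - ∫ x, F ![x, y]‖ ≤ C * B * H ^ M := by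
    intro y
    refine hC (fun x => F ![x, y]) (hvec.comp (contDiff_id.prodMk contDiff_const))
      (fun x => hRx x y) B (fun t => ?_) H hH
    have h := norm_iteratedDeriv_comp_line_le hF hB ![0, y] ![1, 0]
      ((pi_norm_le_iff_of_nonneg zero_le_one).2 fun i => by fin_cases i <;> simp) t
    convert h using 5 with t
    ext i; fin_cases i <;> simp
  have hy : ∀ x, ‖(H : ℂ) * ∑' n : ℤ, F ![x, n * H] - ∫ y, F ![x, y]‖ ≤ C * B * H ^ M := by
    intro x
    refine hC (fun y => F ![x, y]) (hvec.comp (contDiff_const.prodMk contDiff_id))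
      (fun y => hRy x y) B (fun t => ?_) H hH
    have h := norm_iteratedDeriv_comp_line_le hF hB ![x, 0] ![0, 1]
      ((pi_norm_le_iff_of_nonneg zero_le_one).2 fun i => by fin_cases i <;> simp) t
    convert h using 5 with t
    ext i; fin_cases i <;> simp
  set N : ℕ := ⌈|R| / H⌉₊ with hN
  set S : Finset ℤ := Finset.Icc (-N) N with hS
  have hSout : ∀ m ∉ S, ∀ y, F ![m * H, y] = 0 := by
    intro m hm y
    apply hRx
    have h1 : (N : ℤ) < |m| := by
      by_contra h
      exact hm (Finset.mem_Icc.2 (abs_le.1 (not_lt.1 h)))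
    have h2 : |R| / H < |(m : ℝ)| := by
      refine (Nat.le_ceil _).trans_lt ?_
      rw [← hN]; exact_mod_cast h1
    rw [abs_mul, abs_of_pos hH]
    rw [div_lt_iff₀ hH] at h2
    exact (le_abs_self R).trans_lt h2
  have hScard : H * (S.card : ℝ) ≤ 2 * |R| + 3 := by
    have h1 : (S.card : ℝ) = 2 * N + 1 := by
      have : S.card = 2 * N + 1 := by rw [hS, Int.card_Icc]; omega
      rw [this]; push_cast; ring
    have h2 : (N : ℝ) < |R| / H + 1 := Nat.ceil_lt_add_one (by positivity)
    have h3 : H * (|R| / H) = |R| := by field_simp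
    rw [h1]; nlinarith
  have hsum : ∑' j : Fin 2 → ℤ, F (H • latticePt j) = ∑ m ∈ S, ∑' n : ℤ, F ![m * H, n * H] := by
    have h1 : Summable fun p : ℤ × ℤ => F (H • latticePt ((finTwoArrowEquiv ℤ).symm p)) :=
      (finTwoArrowEquiv ℤ).symm.summable_iff.2
        (summable_of_hasFiniteSupport (support_smul_latticePt_finite hR hH))
    have h2 : ∀ m n : ℤ, H • latticePt ((finTwoArrowEquiv ℤ).symm (m, n)) = ![m * H, n * H] := by
      intro m n
      ext i; fin_cases i <;> simp [latticePt, mul_comm]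
    rw [← (finTwoArrowEquiv ℤ).symm.tsum_eq, h1.tsum_prod]
    simp_rw [h2]
    exact tsum_eq_sum fun m hm => by simp [hSout m hm]
  obtain ⟨hInt, hI⟩ := integral_fin_two_eq_integral_integral hF.continuous hcs
  have hslice : ∀ m : ℤ, Integrable fun y => F ![m * H, y] := fun m =>
    (hvec.comp (contDiff_const.prodMk contDiff_id)).continuous.integrable_of_hasCompactSupport
      (hasCompactSupport_of_forall_norm_lt (R := R) fun y => hRy _ y)
  -- The error of the rule in x on the slice at height y.
  set b : ℝ → ℂ := fun y => (H : ℂ) * ∑ m ∈ S, F ![m * H, y] - ∫ x, F ![x, y] with hb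
  have hbI : ∫ y, b y = (H : ℂ) * (∑ m ∈ S, ∫ y, F ![m * H, y]) - ∫ v, F v := by
    rw [hI, hb, integral_sub _ hInt, integral_const_mul, integral_finsetSum _ fun m _ => hslice m]
    exact (integrable_finsetSum _ fun m _ => hslice m).const_mul _
  have hbB : ‖∫ y, b y‖ ≤ C * B * H ^ M * (2 * |R|) := by
    have h0 : ∀ y, y ∉ Set.Icc (-|R|) |R| → b y = 0 := by
      intro y hy
      have : R < |y| := (le_abs_self R).trans_lt (by simpa [Set.mem_Icc, ← abs_le] using hy)
      simp [hb, hRy _ y this]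
    rw [← setIntegral_eq_integral_of_forall_compl_eq_zero h0]
    have := norm_setIntegral_le_of_norm_le_const (μ := volume)
      (s := Set.Icc (-|R|) |R|) (f := b) (C := C * B * H ^ M) (by simp) (fun y _ => by
        have := hx y
        rwa [tsum_eq_sum fun m hm => hSout m hm y] at this)
    rwa [Real.volume_real_Icc_of_le (by linarith [abs_nonneg R]), sub_neg_eq_add, ← two_mul] at this
  have hdecomp : trapezoidError F H =
      H * ∑ m ∈ S, ((H : ℂ) * ∑' n : ℤ, F ![m * H, n * H] - ∫ y, F ![m * H, y]) + ∫ y, b y := by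
    rw [trapezoidError, hsum, hbI, Finset.sum_sub_distrib, ← Finset.mul_sum]
    ring
  rw [hdecomp]
  calc _ ≤ H * (S.card * (C * B * H ^ M)) + C * B * H ^ M * (2 * |R|) := by
        refine (norm_add_le _ _).trans (add_le_add ?_ hbB)
        rw [norm_mul, Complex.norm_of_nonneg hH.le]
        gcongr
        refine (norm_sum_le_of_le S fun m _ => hy (m * H)).trans_eq ?_
        simp
    _ ≤ C * (4 * |R| + 3) * B * H ^ M := by
        have : 0 ≤ C * B * H ^ M := by positivity
        nlinarith

/-! ### The quadratic form and its principal powers -/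

theorem quadForm_eq_sum (A : Matrix (Fin 2) (Fin 2) ℂ) (v : Fin 2 → ℝ) :
    quadForm A v = ∑ i, ∑ j, (v i : ℂ) * (A i j * v j) := by
  simp [quadForm, dotProduct, Matrix.mulVec, mul_add]

theorem contDiff_quadForm (A : Matrix (Fin 2) (Fin 2) ℂ) : ContDiff ℝ ∞ (quadForm A) := by
  have h : ∀ i : Fin 2, ContDiff ℝ ∞ fun v : Fin 2 → ℝ => (v i : ℂ) := fun i =>
    Complex.ofRealCLM.contDiff.comp (contDiff_apply ℝ ℝ i)
  have : quadForm A = fun v => ∑ i, ∑ j, (v i : ℂ) * (A i j * v j) :=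
    funext (quadForm_eq_sum A)
  rw [this]
  exact ContDiff.sum fun i _ => ContDiff.sum fun j _ => (h i).mul (contDiff_const.mul (h j))

theorem quadForm_smul (A : Matrix (Fin 2) (Fin 2) ℂ) (r : ℝ) (v : Fin 2 → ℝ) :
    quadForm A (r • v) = ((r ^ 2 : ℝ) : ℂ) * quadForm A v := by
  simp only [quadForm_eq_sum, Finset.mul_sum, Pi.smul_apply, smul_eq_mul]
  refine Finset.sum_congr rfl fun i _ => Finset.sum_congr rfl fun j _ => ?_
  push_cast; ring

theorem quadForm_neg (A : Matrix (Fin 2) (Fin 2) ℂ) (v : Fin 2 → ℝ) :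
    quadForm A (-v) = quadForm A v := by
  simpa using quadForm_smul A (-1) v

/-- A positive real factor does not change the argument, so the principal power is homogeneous. -/
theorem quadForm_smul_cpow (A : Matrix (Fin 2) (Fin 2) ℂ) {r : ℝ} (hr : 0 < r) (v : Fin 2 → ℝ)
    (s : ℂ) : quadForm A (r • v) ^ s = (r : ℂ) ^ (2 * s) * quadForm A v ^ s := by
  rw [quadForm_smul]
  have hr' : (r : ℂ) ≠ 0 := by exact_mod_cast hr.ne'
  rcases eq_or_ne (quadForm A v) 0 with h | h
  · rcases eq_or_ne s 0 with rfl | hs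
    · simp
    · simp [h, hs]
  · have h2 : 0 < r ^ 2 := by positivity
    have h3 : ((r ^ 2 : ℝ) : ℂ) ≠ 0 := by exact_mod_cast h2.ne'
    rw [Complex.cpow_def_of_ne_zero (mul_ne_zero h3 h), Complex.cpow_def_of_ne_zero h,
      Complex.cpow_def_of_ne_zero hr', Complex.log_ofReal_mul h2 h, ← Complex.exp_add,
      Real.log_pow, ← Complex.ofReal_log hr.le]
    congr 1
    push_cast; ring

section PosDef

variable {A : Matrix (Fin 2) (Fin 2) ℂ} (hre : (A.map Complex.re).PosDef)
include hre

theorem quadForm_re_pos {v : Fin 2 → ℝ} (hv : v ≠ 0) : 0 < (quadForm A v).re := by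
  have h := hre.dotProduct_mulVec_pos hv
  rw [quadForm_eq_sum]
  simpa [dotProduct, Matrix.mulVec, mul_add] using h

theorem quadForm_ne_zero {v : Fin 2 → ℝ} (hv : v ≠ 0) : quadForm A v ≠ 0 := fun h => by
  simpa [h] using quadForm_re_pos hre hv

theorem quadForm_mem_slitPlane {v : Fin 2 → ℝ} (hv : v ≠ 0) : quadForm A v ∈ Complex.slitPlane :=
  Or.inl (quadForm_re_pos hre hv)

theorem exists_le_norm_quadForm_le : ∃ a b : ℝ, 0 < a ∧ 0 < b ∧
    ∀ v, a * ‖v‖ ^ 2 ≤ ‖quadForm A v‖ ∧ ‖quadForm A v‖ ≤ b * ‖v‖ ^ 2 := by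
  have hc : ContinuousOn (fun v => ‖quadForm A v‖) (Metric.sphere (0 : Fin 2 → ℝ) 1) :=
    (contDiff_quadForm A).continuous.norm.continuousOn
  have hne : (Metric.sphere (0 : Fin 2 → ℝ) 1).Nonempty := NormedSpace.sphere_nonempty.2 zero_le_one
  obtain ⟨x, hx, hmin⟩ := (isCompact_sphere (0 : Fin 2 → ℝ) 1).exists_isMinOn hne hc
  obtain ⟨y, hy, hmax⟩ := (isCompact_sphere (0 : Fin 2 → ℝ) 1).exists_isMaxOn hne hc
  have hpos : ∀ x ∈ Metric.sphere (0 : Fin 2 → ℝ) 1, 0 < ‖quadForm A x‖ := fun x hx =>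
    norm_pos_iff.2 (quadForm_ne_zero hre fun h => by simp [h] at hx)
  refine ⟨_, _, hpos x hx, hpos y hy, fun v => ?_⟩
  rcases eq_or_ne v 0 with rfl | hv
  · simp [quadForm_eq_sum]
  · have hv' : 0 < ‖v‖ := norm_pos_iff.2 hv
    have h1 : ‖v‖⁻¹ • v ∈ Metric.sphere (0 : Fin 2 → ℝ) 1 := by
      simp [norm_smul, hv'.ne']
    have h2 : ‖quadForm A v‖ = ‖quadForm A (‖v‖⁻¹ • v)‖ * ‖v‖ ^ 2 := by
      rw [quadForm_smul, norm_mul, Complex.norm_of_nonneg (by positivity)]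
      field_simp
    rw [h2]
    exact ⟨mul_le_mul_of_nonneg_right (hmin h1) (by positivity),
      mul_le_mul_of_nonneg_right (hmax h1) (by positivity)⟩

theorem exists_norm_quadForm_cpow_le (s : ℂ) : ∃ C : ℝ, 0 ≤ C ∧ ∀ v : Fin 2 → ℝ, v ≠ 0 →
    ‖quadForm A v ^ (-s)‖ ≤ C * ‖v‖ ^ (-(2 * s.re)) := by
  obtain ⟨a, b, ha, hb, h⟩ := exists_le_norm_quadForm_le hre
  -- Taking the sum of both powers covers either sign of Re s; the exponential absorbs the argument
  -- of Q, which is at most π in modulus.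
  refine ⟨(a ^ (-s.re) + b ^ (-s.re)) * Real.exp (Real.pi * |s.im|), by positivity, fun v hv => ?_⟩
  have hv' : 0 < ‖v‖ := norm_pos_iff.2 hv
  have hq0 := quadForm_ne_zero hre hv
  have key : ∀ c : ℝ, 0 < c → (c * ‖v‖ ^ 2) ^ (-s.re) = c ^ (-s.re) * ‖v‖ ^ (-(2 * s.re)) := by
    intro c hc
    rw [Real.mul_rpow hc.le (by positivity), ← Real.rpow_natCast, ← Real.rpow_mul hv'.le]
    congr 2; push_cast; ring
  have h1 : ‖quadForm A v‖ ^ (-s.re) ≤ (a ^ (-s.re) + b ^ (-s.re)) * ‖v‖ ^ (-(2 * s.re)) := by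
    rw [add_mul, ← key a ha, ← key b hb]
    have ha' : 0 < a * ‖v‖ ^ 2 := by positivity
    have hb' : 0 < b * ‖v‖ ^ 2 := by positivity
    rcases le_total (-s.re) 0 with hs | hs
    · exact (Real.rpow_le_rpow_of_nonpos ha' (h v).1 hs).trans (le_add_of_nonneg_right (by positivity))
    · exact (Real.rpow_le_rpow (norm_nonneg _) (h v).2 hs).trans
        (le_add_of_nonneg_left (by positivity))
  rw [Complex.norm_cpow_of_ne_zero hq0, div_eq_mul_inv, ← Real.exp_neg, Complex.neg_re,
    Complex.neg_im, mul_right_comm]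
  refine mul_le_mul h1 (Real.exp_le_exp.2 ?_) (Real.exp_pos _).le (by positivity)
  rw [mul_neg, neg_neg]
  refine (le_abs_self _).trans ?_
  rw [abs_mul]
  exact mul_le_mul_of_nonneg_right (Complex.abs_arg_le_pi _) (abs_nonneg _)

/-- Smoothness is joint in (s, v), so that compactness later gives derivative bounds locally uniform
in s. The logarithm is needed for the s-derivative. -/
theorem contDiffAt_quadForm_cpow {p : ℂ × (Fin 2 → ℝ)} (hp : p.2 ≠ 0) :
    ContDiffAt ℝ ∞ (fun p : ℂ × (Fin 2 → ℝ) => quadForm A p.2 ^ (-p.1)) p ∧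
    ContDiffAt ℝ ∞ (fun p : ℂ × (Fin 2 → ℝ) => Complex.log (quadForm A p.2)) p := by
  have hQ : ContDiffAt ℝ ∞ (fun p : ℂ × (Fin 2 → ℝ) => quadForm A p.2) p :=
    ((contDiff_quadForm A).comp contDiff_snd).contDiffAt
  have hlog : ContDiffAt ℝ ∞ (fun p : ℂ × (Fin 2 → ℝ) => Complex.log (quadForm A p.2)) p :=
    ContDiffAt.comp (g := Complex.log) p
      ((Complex.contDiffAt_log (n := ∞) (quadForm_mem_slitPlane hre hp)).restrict_scalars ℝ) hQ
  refine ⟨?_, hlog⟩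
  have hexp : ContDiffAt ℝ ∞ (fun p : ℂ × (Fin 2 → ℝ) =>
      Complex.exp (Complex.log (quadForm A p.2) * -p.1)) p :=
    ContDiffAt.comp (g := Complex.exp) p
      ((Complex.contDiff_exp (𝕜 := ℂ)).restrict_scalars ℝ).contDiffAt
      (hlog.mul contDiffAt_fst.neg)
  refine hexp.congr_of_eventuallyEq ?_
  have : ∀ᶠ x : ℂ × (Fin 2 → ℝ) in 𝓝 p, x.2 ≠ 0 :=
    (continuous_snd.tendsto p).eventually (isOpen_ne.mem_nhds hp)
  filter_upwards [this] with x hx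
  rw [Complex.cpow_def_of_ne_zero (quadForm_ne_zero hre hx)]

end PosDef

/-! ### Annular cutoffs and their integrals -/

/-- A smooth bump function equal to `1` near the origin and supported in the ball of radius `1/2`. -/
noncomputable def latticeBump : ContDiffBump (0 : Fin 2 → ℝ) :=
  ⟨1 / 4, 1 / 2, by norm_num, by norm_num⟩

theorem latticeBump_eq_one {v : Fin 2 → ℝ} (hv : ‖v‖ ≤ 1 / 4) : latticeBump v = 1 :=
  latticeBump.one_of_mem_closedBall (by simpa [latticeBump] using hv)

theorem latticeBump_eq_zero {v : Fin 2 → ℝ} (hv : 1 / 2 ≤ ‖v‖) : latticeBump v = 0 :=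
  latticeBump.zero_of_le_dist (by simpa [latticeBump] using hv)

theorem norm_latticePt (j : Fin 2 → ℤ) : ‖latticePt j‖ = ‖j‖ :=
  enorm_eq_iff_norm_eq.mp rfl

theorem one_le_norm_latticePt {j : Fin 2 → ℤ} (hj : j ≠ 0) : 1 ≤ ‖latticePt j‖ := by
  obtain ⟨i, hi⟩ := Function.ne_iff.1 hj
  refine le_trans ?_ (norm_le_pi_norm (latticePt j) i)
  rw [latticePt, Real.norm_eq_abs]
  exact_mod_cast Int.one_le_abs hi

theorem latticePt_ne_zero {j : Fin 2 → ℤ} (hj : j ≠ 0) : latticePt j ≠ 0 := fun h => by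
  have := one_le_norm_latticePt hj
  rw [h, norm_zero] at this
  linarith

theorem latticeBump_latticePt {j : Fin 2 → ℤ} (hj : j ≠ 0) : latticeBump (latticePt j) = 0 :=
  latticeBump_eq_zero (by linarith [one_le_norm_latticePt hj])

/-- A smooth cutoff to the annulus between the radii `1/4` and `b/2`. -/
noncomputable def annularCutoff (b : ℝ) (v : Fin 2 → ℝ) : ℝ :=
  latticeBump (b⁻¹ • v) - latticeBump v

theorem contDiff_annularCutoff (b : ℝ) : ContDiff ℝ ∞ (annularCutoff b) :=
  (latticeBump.contDiff.comp (contDiff_const_smul b⁻¹)).sub latticeBump.contDiff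

theorem annularCutoff_eq_zero_of_norm_le {b : ℝ} (hb : 1 ≤ b) {v : Fin 2 → ℝ} (hv : ‖v‖ ≤ 1 / 4) :
    annularCutoff b v = 0 := by
  rw [annularCutoff, latticeBump_eq_one hv, latticeBump_eq_one, sub_self]
  rw [norm_smul, norm_inv, Real.norm_of_nonneg (by linarith)]
  exact (mul_le_of_le_one_left (norm_nonneg _) (inv_le_one_of_one_le₀ hb)).trans hv

theorem annularCutoff_eq_zero_of_le_norm {b : ℝ} (hb : 1 ≤ b) {v : Fin 2 → ℝ} (hv : b / 2 ≤ ‖v‖) :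
    annularCutoff b v = 0 := by
  rw [annularCutoff, latticeBump_eq_zero (v := v) (by linarith), latticeBump_eq_zero, sub_self]
  rw [norm_smul, norm_inv, Real.norm_of_nonneg (by linarith), ← div_eq_inv_mul,
    le_div_iff₀ (by linarith)]
  linarith

/-- The terms χ(v/a) telescope. This cocycle identity drives both the dyadic decomposition and the
continuation of the bump integral. -/
theorem annularCutoff_mul (a b : ℝ) (v : Fin 2 → ℝ) :
    annularCutoff (a * b) v = annularCutoff a v + annularCutoff b (a⁻¹ • v) := by
  simp only [annularCutoff, smul_smul, mul_inv, mul_comm]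
  ring

/-- The cutoff vanishes identically near v = 0, the only place where W may be singular. -/
theorem contDiff_annularCutoff_mul {b : ℝ} (hb : 1 ≤ b) {W : ℂ × (Fin 2 → ℝ) → ℂ}
    (hW : ∀ p : ℂ × (Fin 2 → ℝ), p.2 ≠ 0 → ContDiffAt ℝ ∞ W p) :
    ContDiff ℝ ∞ fun p : ℂ × (Fin 2 → ℝ) => (annularCutoff b p.2 : ℂ) * W p := by
  have hψ : ContDiff ℝ ∞ fun p : ℂ × (Fin 2 → ℝ) => (annularCutoff b p.2 : ℂ) :=
    Complex.ofRealCLM.contDiff.comp ((contDiff_annularCutoff b).comp contDiff_snd)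
  refine contDiff_iff_contDiffAt.2 fun p => ?_
  by_cases hp : p.2 = 0
  · have : ∀ᶠ x : ℂ × (Fin 2 → ℝ) in 𝓝 p, x.2 ∈ Metric.ball (0 : Fin 2 → ℝ) (1 / 4) :=
      continuous_snd.continuousAt.eventually_mem
        (Metric.isOpen_ball.mem_nhds (by rw [hp]; exact Metric.mem_ball_self (by norm_num)))
    refine (contDiffAt_const (c := (0 : ℂ))).congr_of_eventuallyEq ?_
    filter_upwards [this] with x hx
    rw [annularCutoff_eq_zero_of_norm_le hb (by simpa using (mem_ball_zero_iff.1 hx).le)]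
    simp
  · exact hψ.contDiffAt.mul (hW p hp)

/-- The function `v ↦ Q_A(v) ^ (-s)`, cut off to an annulus. -/
noncomputable def annularPower (A : Matrix (Fin 2) (Fin 2) ℂ) (b : ℝ) (s : ℂ) (v : Fin 2 → ℝ) : ℂ :=
  (annularCutoff b v : ℂ) * quadForm A v ^ (-s)

/-- The integral of `Q_A ^ (-s)`, cut off to an annulus. -/
noncomputable def annularIntegral (A : Matrix (Fin 2) (Fin 2) ℂ) (b : ℝ) (s : ℂ) : ℂ :=
  ∫ v, annularPower A b s v

theorem annularPower_eq_zero {A : Matrix (Fin 2) (Fin 2) ℂ} {b : ℝ} (hb : 1 ≤ b) {s : ℂ}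
    {v : Fin 2 → ℝ} (hv : b / 2 < ‖v‖) : annularPower A b s v = 0 := by
  simp [annularPower, annularCutoff_eq_zero_of_le_norm hb hv.le]

theorem differentiable_integral_of_continuous {F F' : ℂ → (Fin 2 → ℝ) → ℂ}
    (hF : Continuous F.uncurry) (hF' : Continuous F'.uncurry) {R : ℝ}
    (hR : ∀ s v, R < ‖v‖ → F s v = 0) (hR' : ∀ s v, R < ‖v‖ → F' s v = 0)
    (hd : ∀ s v, HasDerivAt (fun s => F s v) (F' s v) s) :
    Differentiable ℂ fun s => ∫ v, F s v := by
  intro s₀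
  have hc : ∀ s, Continuous (F s) := fun s => hF.comp (Continuous.prodMk_right s)
  have hc' : ∀ s, Continuous (F' s) := fun s => hF'.comp (Continuous.prodMk_right s)
  obtain ⟨C, hC⟩ := (((isCompact_closedBall s₀ 1).prod
    (isCompact_closedBall (0 : Fin 2 → ℝ) R)).bddAbove_image hF'.norm.continuousOn)
  refine (hasDerivAt_integral_of_dominated_loc_of_deriv_le (F := F) (F' := F')
    (bound := (Metric.closedBall (0 : Fin 2 → ℝ) R).indicator fun _ => C)
    (Metric.ball_mem_nhds s₀ one_pos) ?_ ?_ ?_ ?_ ?_ ?_).2.differentiableAt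
  · exact Eventually.of_forall fun s => (hc s).aestronglyMeasurable
  · exact (hc s₀).integrable_of_hasCompactSupport (hasCompactSupport_of_forall_norm_lt (hR s₀))
  · exact (hc' s₀).aestronglyMeasurable
  · refine Eventually.of_forall fun v s hs => ?_
    by_cases hv : v ∈ Metric.closedBall (0 : Fin 2 → ℝ) R
    · rw [Set.indicator_of_mem hv]
      exact hC ⟨(s, v), ⟨Metric.ball_subset_closedBall hs, hv⟩, rfl⟩
    · rw [Set.indicator_of_notMem hv, hR' s v (by simpa using hv), norm_zero]
  · exact (integrableOn_const (measure_closedBall_lt_top.ne)).integrable_indicator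
      measurableSet_closedBall
  · exact Eventually.of_forall fun v s _ => hd s v

section PosDef

variable {A : Matrix (Fin 2) (Fin 2) ℂ} (hre : (A.map Complex.re).PosDef)
include hre

theorem contDiff_annularPower_uncurry {b : ℝ} (hb : 1 ≤ b) :
    ContDiff ℝ ∞ fun p : ℂ × (Fin 2 → ℝ) => annularPower A b p.1 p.2 :=
  contDiff_annularCutoff_mul hb fun _ hp => (contDiffAt_quadForm_cpow hre hp).1

theorem contDiff_annularPower {b : ℝ} (hb : 1 ≤ b) (s : ℂ) : ContDiff ℝ ∞ (annularPower A b s) :=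
  ContDiff.comp (g := fun p : ℂ × (Fin 2 → ℝ) => annularPower A b p.1 p.2)
    (f := fun v : Fin 2 → ℝ => (s, v))
    (contDiff_annularPower_uncurry hre hb) (contDiff_const.prodMk contDiff_id)

theorem integrable_annularPower {b : ℝ} (hb : 1 ≤ b) (s : ℂ) : Integrable (annularPower A b s) :=
  (contDiff_annularPower hre hb s).continuous.integrable_of_hasCompactSupport
    (hasCompactSupport_of_forall_norm_lt fun _ => annularPower_eq_zero hb)

theorem hasDerivAt_annularPower {b : ℝ} (hb : 1 ≤ b) (s : ℂ) (v : Fin 2 → ℝ) :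
    HasDerivAt (fun s => annularPower A b s v)
      (annularCutoff b v * (-(quadForm A v ^ (-s)) * Complex.log (quadForm A v))) s := by
  rcases eq_or_ne v 0 with rfl | hv
  · have h0 : annularCutoff b 0 = 0 := annularCutoff_eq_zero_of_norm_le hb (by simp)
    simpa [annularPower, h0] using hasDerivAt_const s (0 : ℂ)
  · refine HasDerivAt.const_mul _ ?_
    have := (hasDerivAt_neg s).const_cpow (c := quadForm A v) (Or.inl (quadForm_ne_zero hre hv))
    simpa [mul_comm] using this

theorem differentiable_annularIntegral {b : ℝ} (hb : 1 ≤ b) :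
    Differentiable ℂ (annularIntegral A b) := by
  refine differentiable_integral_of_continuous (R := b / 2)
    (contDiff_annularPower_uncurry hre hb).continuous
    (F' := fun s v => annularCutoff b v * (-(quadForm A v ^ (-s)) * Complex.log (quadForm A v)))
    (contDiff_annularCutoff_mul hb fun p hp => ?_).continuous (fun _ _ => annularPower_eq_zero hb)
    (fun s v hv => ?_) (hasDerivAt_annularPower hre hb)
  · exact (contDiffAt_quadForm_cpow hre hp).1.neg.mul (contDiffAt_quadForm_cpow hre hp).2
  · simp [annularCutoff_eq_zero_of_le_norm hb hv.le]

omit hre in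
theorem annularPower_mul {a : ℝ} (ha : 1 ≤ a) (b : ℝ) (s : ℂ) (v : Fin 2 → ℝ) :
    annularPower A (a * b) s v =
      annularPower A a s v + (a : ℂ) ^ (-(2 * s)) * annularPower A b s (a⁻¹ • v) := by
  have ha0 : 0 < a := by linarith
  have h : quadForm A v ^ (-s) = (a : ℂ) ^ (-(2 * s)) * quadForm A (a⁻¹ • v) ^ (-s) := by
    conv_lhs => rw [← smul_inv_smul₀ ha0.ne' v]
    rw [quadForm_smul_cpow A ha0, mul_neg]
  simp only [annularPower]
  rw [annularCutoff_mul, Complex.ofReal_add, add_mul]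
  conv_lhs => rw [h]
  conv_rhs => rw [h]
  ring

/-- In the cocycle identity, the substitution v ↦ av contributes a² and homogeneity contributes
a^(−2s). -/
theorem annularIntegral_mul {a b : ℝ} (ha : 1 ≤ a) (hb : 1 ≤ b) (s : ℂ) :
    annularIntegral A (a * b) s =
      annularIntegral A a s + (a : ℂ) ^ (2 - 2 * s) * annularIntegral A b s := by
  have ha0 : 0 < a := by linarith
  simp only [annularIntegral]
  have h1 : Integrable fun v => (a : ℂ) ^ (-(2 * s)) * annularPower A b s (a⁻¹ • v) :=
    ((integrable_annularPower hre hb s).comp_smul (inv_ne_zero ha0.ne')).const_mul _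
  simp_rw [annularPower_mul ha b s]
  rw [integral_add (integrable_annularPower hre ha s) h1, integral_const_mul,
    Measure.integral_comp_inv_smul, sub_eq_add_neg,
    Complex.cpow_add _ _ (by exact_mod_cast ha0.ne')]
  simp
  ring

end PosDef

/-! ### Dyadic decomposition of the trapezoidal error -/

theorem trapezoidError_comp_smul (F : (Fin 2 → ℝ) → ℂ) {r : ℝ} (hr : 0 < r) :
    (r : ℂ) ^ 2 * trapezoidError (fun v => F (r • v)) r⁻¹ = trapezoidError F 1 := by
  have hr' : (r : ℂ) ≠ 0 := by exact_mod_cast hr.ne'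
  simp only [trapezoidError, smul_inv_smul₀ hr.ne', one_smul]
  rw [Measure.integral_comp_smul_of_nonneg volume F r (hR := hr.le), Module.finrank_fin_fun]
  rw [mul_sub, Complex.real_smul]
  push_cast
  field_simp

theorem trapezoidError_add {F G : (Fin 2 → ℝ) → ℂ} (hF : Continuous F) (hG : Continuous G) {R : ℝ}
    (hFR : ∀ v, R < ‖v‖ → F v = 0) (hGR : ∀ v, R < ‖v‖ → G v = 0) {H : ℝ} (hH : 0 < H) :
    trapezoidError (fun v => F v + G v) H = trapezoidError F H + trapezoidError G H := by
  rw [trapezoidError, integral_add (hF.integrable_of_hasCompactSupport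
    (hasCompactSupport_of_forall_norm_lt hFR)) (hG.integrable_of_hasCompactSupport
    (hasCompactSupport_of_forall_norm_lt hGR)), Summable.tsum_add
    (summable_of_hasFiniteSupport (support_smul_latticePt_finite hFR hH))
    (summable_of_hasFiniteSupport (support_smul_latticePt_finite hGR hH)), trapezoidError,
    trapezoidError]
  ring

theorem trapezoidError_const_mul (c : ℂ) (F : (Fin 2 → ℝ) → ℂ) (H : ℝ) :
    trapezoidError (fun v => c * F v) H = c * trapezoidError F H := by
  rw [trapezoidError, tsum_mul_left, integral_const_mul, trapezoidError]
  ring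

section PosDef

variable {A : Matrix (Fin 2) (Fin 2) ℂ} (hre : (A.map Complex.re).PosDef)
include hre

/-- Induction on K: passing from 2^K to 2^(K+1) adds one annulus, and rescaling it by 2^K to the
fixed annulus turns step 1 into step 2^(−K). -/
theorem trapezoidError_annularPower_two_pow (s : ℂ) {G : (Fin 2 → ℝ) → ℂ} (hG : Continuous G)
    (K : ℕ) :
    trapezoidError (fun v => annularPower A (2 ^ K) s v * G v) 1 =
      ∑ k ∈ Finset.range K, (((2 : ℝ) ^ k : ℝ) : ℂ) ^ (2 - 2 * s) *
        trapezoidError (fun v => annularPower A 2 s v * G ((2 : ℝ) ^ k • v)) ((2 : ℝ) ^ k)⁻¹ := by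
  induction K with
  | zero => simp [annularPower, annularCutoff, trapezoidError]
  | succ K ih =>
    set r : ℝ := 2 ^ K with hr
    have hr1 : 1 ≤ r := one_le_pow₀ one_le_two
    have hr0 : 0 < r := by linarith
    have hr' : (r : ℂ) ≠ 0 := by exact_mod_cast hr0.ne'
    rw [Finset.sum_range_succ, ← ih, pow_succ, ← hr]
    have h1 : (fun v => annularPower A (r * 2) s v * G v) = fun v => annularPower A r s v * G v +
        (r : ℂ) ^ (-(2 * s)) * (annularPower A 2 s (r⁻¹ • v) * G v) := by
      ext v
      rw [annularPower_mul hr1]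
      ring
    have hc : Continuous fun v => annularPower A 2 s (r⁻¹ • v) * G v :=
      ((contDiff_annularPower hre one_le_two s).continuous.comp (continuous_const_smul r⁻¹)).mul hG
    have hsupp : ∀ v : Fin 2 → ℝ, r < ‖v‖ → annularPower A 2 s (r⁻¹ • v) * G v = 0 := by
      intro v hv
      rw [annularPower_eq_zero one_le_two, zero_mul]
      rw [norm_smul, norm_inv, Real.norm_of_nonneg hr0.le, ← div_eq_inv_mul, div_self two_ne_zero,
        lt_div_iff₀ hr0]
      linarith
    rw [h1, trapezoidError_add (F := fun v => annularPower A r s v * G v)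
      (G := fun v => (r : ℂ) ^ (-(2 * s)) * (annularPower A 2 s (r⁻¹ • v) * G v))
      ((contDiff_annularPower hre hr1 s).continuous.mul hG) (continuous_const.mul hc) (R := r) (fun v hv => ?_) (fun v hv => ?_) one_pos,
      trapezoidError_const_mul, ← trapezoidError_comp_smul (fun v => annularPower A 2 s (r⁻¹ • v) * G v) hr0, ← mul_assoc]
    · congr 2
      · rw [sub_eq_add_neg, Complex.cpow_add _ _ hr', Complex.cpow_ofNat, mul_comm]
      · simp only [inv_smul_smul₀ hr0.ne']
    · rw [annularPower_eq_zero hr1 (by linarith), zero_mul]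
    · rw [hsupp v hv, mul_zero]

/-! ### Continuation of the bump integral -/

/-- For `s ≠ 1`, the continuation of the integral of `latticeBump * Q_A ^ (-s)`. -/
noncomputable def bumpIntegral (A : Matrix (Fin 2) (Fin 2) ℂ) (s : ℂ) : ℂ :=
  annularIntegral A (Real.exp ‖2 - 2 * s‖⁻¹) s /
    ((Real.exp ‖2 - 2 * s‖⁻¹ : ℝ) ^ (2 - 2 * s) - 1)

-- The power is exp(w/‖w‖), whose exponent has modulus 1 and so is not a multiple of 2πi. Hence the
-- denominator of `bumpIntegral` does not vanish when s ≠ 1.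
omit hre in
theorem exp_inv_norm_cpow_ne_one {w : ℂ} (hw : w ≠ 0) :
    ((Real.exp ‖w‖⁻¹ : ℝ) : ℂ) ^ w ≠ 1 := by
  rw [Complex.cpow_def_of_ne_zero (by exact_mod_cast (Real.exp_pos _).ne'),
    ← Complex.ofReal_log (Real.exp_pos _).le, Real.log_exp, Ne, Complex.exp_eq_one_iff]
  rintro ⟨n, hn⟩
  have h1 := congrArg norm hn
  have hw' : ‖w‖ ≠ 0 := norm_ne_zero_iff.2 hw
  simp only [norm_mul, Complex.norm_real, norm_inv, abs_norm, inv_mul_cancel₀ hw',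
    Complex.norm_intCast, Complex.norm_I, Complex.norm_ofNat, mul_one, Real.norm_eq_abs,
    abs_of_pos Real.pi_pos] at h1
  rcases eq_or_ne n 0 with rfl | h0
  · norm_num at h1
  · have h2 : (1 : ℝ) ≤ |(n : ℝ)| := by exact_mod_cast Int.one_le_abs h0
    nlinarith [Real.pi_gt_three]

omit hre in
theorem two_sub_two_mul_ne_zero {s : ℂ} (hs : s ≠ 1) : 2 - 2 * s ≠ 0 := by
  intro h
  apply hs
  linear_combination -h / 2

/-- Expanding the integral for ab = ba by the cocycle identity in both orders shows that its ratio
to a^(2−2s) − 1 does not depend on a. -/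
theorem annularIntegral_eq_bumpIntegral_mul {s : ℂ} (hs : s ≠ 1) {a : ℝ} (ha : 1 ≤ a) :
    annularIntegral A a s = bumpIntegral A s * ((a : ℂ) ^ (2 - 2 * s) - 1) := by
  set b := Real.exp ‖2 - 2 * s‖⁻¹ with hb
  have hb1 : 1 ≤ b := Real.one_le_exp (by positivity)
  have hne : (b : ℂ) ^ (2 - 2 * s) - 1 ≠ 0 :=
    sub_ne_zero.2 (exp_inv_norm_cpow_ne_one (two_sub_two_mul_ne_zero hs))
  have h1 := annularIntegral_mul hre ha hb1 s
  rw [mul_comm, annularIntegral_mul hre hb1 ha s] at h1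
  rw [bumpIntegral, ← hb, div_mul_eq_mul_div, eq_div_iff hne]
  linear_combination h1

theorem differentiableOn_bumpIntegral : DifferentiableOn ℂ (bumpIntegral A) {1}ᶜ := by
  intro s₀ hs₀
  -- The radius in `bumpIntegral` varies non-holomorphically with s; independence of the radius
  -- allows freezing it at its value for s₀.
  set b := Real.exp ‖2 - 2 * s₀‖⁻¹ with hb
  have hb1 : 1 ≤ b := Real.one_le_exp (by positivity)
  have hb0 : (b : ℂ) ≠ 0 := by exact_mod_cast (Real.exp_pos _).ne'
  have hne : (b : ℂ) ^ (2 - 2 * s₀) - 1 ≠ 0 :=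
    sub_ne_zero.2 (exp_inv_norm_cpow_ne_one (two_sub_two_mul_ne_zero hs₀))
  have hd : Differentiable ℂ fun s : ℂ => (b : ℂ) ^ (2 - 2 * s) - 1 := fun s =>
    ((((differentiableAt_const _).sub (differentiableAt_id.const_mul _)).const_cpow
      (Or.inl hb0)).sub_const _)
  have hdiv : DifferentiableAt ℂ
      (fun s => annularIntegral A b s / ((b : ℂ) ^ (2 - 2 * s) - 1)) s₀ :=
    (differentiable_annularIntegral hre hb1 s₀).div (hd s₀) hne
  refine (hdiv.congr_of_eventuallyEq ?_).differentiableWithinAt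
  filter_upwards [hd.continuous.continuousAt.eventually_ne hne,
    isOpen_compl_singleton.mem_nhds hs₀] with s h1 h2
  rw [eq_div_iff h1, annularIntegral_eq_bumpIntegral_mul hre h2 hb1]

/-- Near 0 the integrand is O(‖v‖^(−2s)), and 2s is less than the dimension 2. -/
theorem integrable_mul_quadForm_cpow {G : (Fin 2 → ℝ) → ℂ} (hG : Continuous G)
    (hc : HasCompactSupport G) {s : ℝ} (hs : s < 1) :
    Integrable fun v => G v * quadForm A v ^ (-(s : ℂ)) := by
  obtain ⟨C, hC0, hC⟩ := exists_norm_quadForm_cpow_le hre (s : ℂ)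
  obtain ⟨D, hD⟩ := hc.exists_bound_of_continuous hG
  obtain ⟨R, hR⟩ := hc.isCompact.isBounded.subset_ball 0
  have hD0 : 0 ≤ D := (norm_nonneg _).trans (hD 0)
  have hm : AEStronglyMeasurable (fun v => G v * quadForm A v ^ (-(s : ℂ))) :=
    (hG.measurable.mul ((contDiff_quadForm A).continuous.measurable.pow_const _)).aestronglyMeasurable
  have hae : ∀ᵐ v : Fin 2 → ℝ, v ≠ 0 := by
    simp [ae_iff]
  have := integrableOn_ball_of_norm_le_rpow (μ := (volume : Measure (Fin 2 → ℝ))) (by simp)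
    (C := D * C) (α := 2 * s) (r := R) (by simp; linarith)
    (ae_restrict_of_ae (hae.mono fun v hv => ?_)) hm
  · refine this.integrable_of_forall_notMem_eq_zero fun v hv => ?_
    rw [image_eq_zero_of_notMem_tsupport fun h => hv (hR h), zero_mul]
  · rw [norm_mul, mul_assoc]
    have := hC v hv
    rw [Complex.ofReal_re] at this
    exact mul_le_mul (hD v) this (norm_nonneg _) hD0

/-- When s < 1 both pieces of ψ_2 Q^(−s) are integrable, so the integral splits as (2^(2−2s) − 1) ∫
χ Q^(−s), and this factor is nonzero. -/
theorem integral_latticeBump_mul {s : ℝ} (hs : s < 1) :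
    ∫ v, (latticeBump v : ℂ) * quadForm A v ^ (-(s : ℂ)) = bumpIntegral A s := by
  have hcB : Continuous fun v => (latticeBump v : ℂ) :=
    Complex.continuous_ofReal.comp latticeBump.continuous
  have hcs : HasCompactSupport fun v => (latticeBump v : ℂ) :=
    latticeBump.hasCompactSupport.comp_left Complex.ofReal_zero
  set f : (Fin 2 → ℝ) → ℂ := fun v => (latticeBump v : ℂ) * quadForm A v ^ (-(s : ℂ)) with hf
  have hint : Integrable f := integrable_mul_quadForm_cpow hre hcB hcs hs
  have hs1 : (s : ℂ) ≠ 1 := by exact_mod_cast hs.ne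
  have h1 : ∀ v, annularPower A 2 s v = (2 : ℂ) ^ (-(2 * (s : ℂ))) * f ((2 : ℝ)⁻¹ • v) - f v := by
    intro v
    have h : quadForm A v ^ (-(s : ℂ)) =
        (2 : ℂ) ^ (-(2 * (s : ℂ))) * quadForm A ((2 : ℝ)⁻¹ • v) ^ (-(s : ℂ)) := by
      conv_lhs => rw [← smul_inv_smul₀ (two_ne_zero (α := ℝ)) v]
      rw [quadForm_smul_cpow A two_pos, mul_neg]
      norm_num
    simp only [annularPower, annularCutoff, hf, Complex.ofReal_sub, sub_mul]
    congr 1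
    rw [h]; ring
  have h2 : annularIntegral A 2 s = ((2 : ℂ) ^ (2 - 2 * (s : ℂ)) - 1) * ∫ v, f v := by
    simp only [annularIntegral, h1]
    rw [integral_sub ((hint.comp_smul (by norm_num)).const_mul _) hint, integral_const_mul,
      Measure.integral_comp_inv_smul, sub_eq_add_neg (2 : ℂ),
      Complex.cpow_add _ _ two_ne_zero]
    simp
    ring
  rw [annularIntegral_eq_bumpIntegral_mul hre hs1 one_le_two, mul_comm] at h2
  refine (mul_left_cancel₀ ?_ h2).symm
  rw [sub_ne_zero]
  intro h
  have := congrArg norm h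
  have h3 : ‖(2 : ℂ) ^ (2 - 2 * (s : ℂ))‖ = (2 : ℝ) ^ (2 - 2 * s) := by
    have := Complex.norm_cpow_eq_rpow_re_of_pos two_pos (2 - 2 * (s : ℂ))
    simpa using this
  rw [Complex.ofReal_ofNat, h3, norm_one] at this
  linarith [Real.one_lt_rpow one_lt_two (show 0 < 2 - 2 * s by linarith)]

end PosDef

theorem iteratedFDeriv_eq_zero_of_norm_lt {E : Type*} [NormedAddCommGroup E] [NormedSpace ℝ E]
    {F : E → ℂ} {R : ℝ} (hR : ∀ v, R < ‖v‖ → F v = 0) (M : ℕ) {v : E} (hv : R < ‖v‖) :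
    iteratedFDeriv ℝ M F v = 0 := by
  by_contra h
  have h1 : v ∈ tsupport F := support_iteratedFDeriv_subset (𝕜 := ℝ) M h
  have h2 : tsupport F ⊆ Metric.closedBall 0 R := by
    refine closure_minimal (fun x hx => ?_) Metric.isClosed_closedBall
    by_contra h'
    exact hx (hR x (by simpa using h'))
  have := h2 h1
  rw [mem_closedBall_zero_iff] at this
  linarith

theorem tsum_subtype_ne_zero {f : (Fin 2 → ℤ) → ℂ} (h : f 0 = 0) :
    ∑' j : {j : Fin 2 → ℤ // j ≠ 0}, f j = ∑' j, f j :=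
  tsum_subtype_eq_of_support_subset (s := {j | j ≠ 0}) fun j hj h0 => hj (by rw [h0, h])

theorem latticePt_zero : latticePt 0 = 0 := by
  ext i; simp [latticePt]

theorem norm_two_pow_cpow (k : ℕ) (w : ℂ) :
    ‖(((2 : ℝ) ^ k : ℝ) : ℂ) ^ w‖ = ((2 : ℝ) ^ w.re) ^ k := by
  rw [Complex.norm_cpow_eq_rpow_re_of_pos (by positivity), ← Real.rpow_natCast,
    ← Real.rpow_natCast, ← Real.rpow_mul two_pos.le, ← Real.rpow_mul two_pos.le, mul_comm]

/-! ### Continuation of the Epstein zeta function -/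

/-- The analytic continuation of the Epstein zeta function, as a sum over dyadic annuli. -/
noncomputable def dyadicZeta (A : Matrix (Fin 2) (Fin 2) ℂ) (s : ℂ) : ℂ :=
  ∑' k : ℕ, (((2 : ℝ) ^ k : ℝ) : ℂ) ^ (2 - 2 * s) *
    trapezoidError (annularPower A 2 s) ((2 : ℝ) ^ k)⁻¹ - bumpIntegral A s

section PosDef

variable {A : Matrix (Fin 2) (Fin 2) ℂ} (hre : (A.map Complex.re).PosDef)
include hre

theorem exists_norm_iteratedFDeriv_annularPower_le {b : ℝ} (hb : 1 ≤ b) (M : ℕ) (ρ : ℝ) :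
    ∃ B : ℝ, 0 ≤ B ∧ ∀ s : ℂ, ‖s‖ ≤ ρ → ∀ v, ‖iteratedFDeriv ℝ M (annularPower A b s) v‖ ≤ B := by
  have hJ := contDiff_annularPower_uncurry hre hb
  have hc : Continuous (iteratedFDeriv ℝ M fun p : ℂ × (Fin 2 → ℝ) => annularPower A b p.1 p.2) :=
    hJ.continuous_iteratedFDeriv (by exact_mod_cast le_top)
  obtain ⟨B, hB⟩ := ((isCompact_closedBall (0 : ℂ) ρ).prod
    (isCompact_closedBall (0 : Fin 2 → ℝ) (b / 2))).exists_bound_of_continuousOn hc.continuousOn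
  refine ⟨|B|, abs_nonneg _, fun s hs v => ?_⟩
  by_cases hv : b / 2 < ‖v‖
  · rw [iteratedFDeriv_eq_zero_of_norm_lt (fun _ => annularPower_eq_zero hb) M hv, norm_zero]
    exact abs_nonneg _
  · have h1 := norm_iteratedFDeriv_comp_affine_le hJ M (s, 0)
      (ContinuousLinearMap.inr ℝ ℂ (Fin 2 → ℝ)) v
    have h2 : (fun v : Fin 2 → ℝ => annularPower A b ((s, 0) +
        ContinuousLinearMap.inr ℝ ℂ (Fin 2 → ℝ) v).1 ((s, 0) +
        ContinuousLinearMap.inr ℝ ℂ (Fin 2 → ℝ) v).2) = annularPower A b s := by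
      ext v; simp
    rw [h2] at h1
    refine h1.trans ((mul_le_of_le_one_right (norm_nonneg _) (pow_le_one₀ (norm_nonneg _)
      (ContinuousLinearMap.norm_inr_le_one ℝ ℂ (Fin 2 → ℝ)))).trans ((hB _ ?_).trans (le_abs_self _)))
    simpa using ⟨hs, not_lt.1 hv⟩

theorem exists_norm_two_pow_cpow_mul_trapezoidError_le (ρ : ℝ) :
    ∃ C : ℝ, 0 ≤ C ∧ ∀ s : ℂ, ‖s‖ ≤ ρ → ∀ k : ℕ, ‖(((2 : ℝ) ^ k : ℝ) : ℂ) ^ (2 - 2 * s) *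
      trapezoidError (annularPower A 2 s) ((2 : ℝ) ^ k)⁻¹‖ ≤ C * (1 / 2) ^ k := by
  -- N dominates Re(2 − 2s) on ‖s‖ ≤ ρ; using N + 1 derivatives leaves a geometric factor 2^(−k).
  set N : ℕ := ⌈2 + 2 * |ρ|⌉₊ with hN
  have hN2 : 2 + 2 * |ρ| ≤ N := Nat.le_ceil _
  have hN2' : (2 : ℝ) ≤ N := by linarith [abs_nonneg ρ]
  obtain ⟨B, hB0, hB⟩ := exists_norm_iteratedFDeriv_annularPower_le hre one_le_two (N + 1) ρ
  obtain ⟨C, hC0, hC⟩ := exists_norm_trapezoidError_le (N + 1)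
    (by have : 2 ≤ N := by exact_mod_cast hN2'
        omega) (2 / 2)
  refine ⟨C * B, by positivity, fun s hs k => ?_⟩
  have h2k : (1 : ℝ) ≤ 2 ^ k := one_le_pow₀ one_le_two
  have h1 := hC _ (contDiff_annularPower hre one_le_two s) (fun _ => annularPower_eq_zero one_le_two)
    B (hB s hs) ((2 : ℝ) ^ k)⁻¹ (by positivity) (inv_le_one_of_one_le₀ h2k)
  have h2 : (2 : ℝ) ^ (2 - 2 * s).re ≤ 2 ^ N := by
    rw [← Real.rpow_natCast]
    refine Real.rpow_le_rpow_of_exponent_le one_le_two ?_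
    have := (abs_le.1 (Complex.abs_re_le_norm s)).1
    simp
    linarith [le_abs_self ρ]
  rw [norm_mul, norm_two_pow_cpow]
  calc _ ≤ ((2 : ℝ) ^ N) ^ k * (C * B * ((2 : ℝ) ^ k)⁻¹ ^ (N + 1)) := by gcongr
    _ = C * B * (1 / 2) ^ k := by
      rw [pow_succ, ← inv_pow, ← pow_mul, ← pow_mul, mul_comm k N, inv_pow, one_div]
      field_simp

omit hre in
theorem summable_mul_one_half_pow (C : ℝ) : Summable fun k : ℕ => C * (1 / 2 : ℝ) ^ k :=
  summable_geometric_two.mul_left C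

theorem differentiable_trapezoidError_annularPower {H : ℝ} (hH : 0 < H) :
    Differentiable ℂ fun s => trapezoidError (annularPower A 2 s) H := by
  have hfin := finite_setOf_norm_smul_latticePt_le hH 1
  have h : ∀ s, trapezoidError (annularPower A 2 s) H =
      (H : ℂ) ^ 2 * ∑ j ∈ hfin.toFinset, annularPower A 2 s (H • latticePt j) -
        annularIntegral A 2 s := by
    intro s
    rw [trapezoidError, annularIntegral, tsum_eq_sum fun j hj => ?_]
    rw [Set.Finite.mem_toFinset, Set.mem_ofPred_eq, not_le] at hj
    exact annularPower_eq_zero one_le_two (by linarith)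
  simp_rw [h]
  refine Differentiable.sub (Differentiable.const_mul (Differentiable.fun_sum fun j _ s => ?_) _)
    (differentiable_annularIntegral hre one_le_two)
  exact (hasDerivAt_annularPower hre one_le_two s _).differentiableAt

theorem differentiableOn_dyadicZeta : DifferentiableOn ℂ (dyadicZeta A) {1}ᶜ := by
  refine DifferentiableOn.sub (Differentiable.differentiableOn fun s₀ => ?_)
    (differentiableOn_bumpIntegral hre)
  obtain ⟨C, hC0, hC⟩ := exists_norm_two_pow_cpow_mul_trapezoidError_le hre (‖s₀‖ + 1)
  have h := Complex.differentiableOn_tsum_of_summable_norm (U := Metric.ball s₀ 1)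
    (F := fun (k : ℕ) s => (((2 : ℝ) ^ k : ℝ) : ℂ) ^ (2 - 2 * s) *
      trapezoidError (annularPower A 2 s) ((2 : ℝ) ^ k)⁻¹)
    (summable_mul_one_half_pow C) (fun k => ?_) Metric.isOpen_ball (fun k s hs => hC s ?_ k)
  · exact h.differentiableAt (Metric.ball_mem_nhds s₀ one_pos)
  · have h2 : (((2 : ℝ) ^ k : ℝ) : ℂ) ≠ 0 := by
      exact_mod_cast (pow_pos two_pos k).ne'
    refine Differentiable.differentiableOn (Differentiable.mul (fun s => ?_)
      (differentiable_trapezoidError_annularPower hre (by positivity)))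
    exact ((differentiableAt_const _).sub (differentiableAt_id.const_mul _)).const_cpow (Or.inl h2)
  · rw [mem_ball_iff_norm] at hs
    linarith [norm_sub_norm_le s s₀]

theorem hasSum_two_pow_cpow_mul_trapezoidError {s : ℂ} : HasSum (fun k : ℕ =>
    (((2 : ℝ) ^ k : ℝ) : ℂ) ^ (2 - 2 * s) *
      trapezoidError (annularPower A 2 s) ((2 : ℝ) ^ k)⁻¹) (dyadicZeta A s + bumpIntegral A s) := by
  obtain ⟨C, hC0, hC⟩ := exists_norm_two_pow_cpow_mul_trapezoidError_le hre ‖s‖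
  have := ((summable_mul_one_half_pow C).of_norm_bounded (hC s le_rfl)).hasSum
  rwa [dyadicZeta, sub_add_cancel]

omit hre in
theorem tendsto_latticeBump (v : Fin 2 → ℝ) :
    ∀ᶠ K : ℕ in atTop, latticeBump (((2 : ℝ) ^ K)⁻¹ • v) = 1 := by
  filter_upwards [(tendsto_pow_atTop_atTop_of_one_lt (one_lt_two (α := ℝ))).eventually_ge_atTop
    (4 * ‖v‖)] with K hK
  refine latticeBump_eq_one ?_
  rw [norm_smul, norm_inv, Real.norm_of_nonneg (by positivity), ← div_eq_inv_mul,
    div_le_iff₀ (by positivity)]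
  linarith

theorem isEpsteinContinuation_dyadicZeta : IsEpsteinContinuation A (dyadicZeta A) := by
  refine ⟨differentiableOn_dyadicZeta hre, fun s hs => ?_⟩
  have hs1 : s ≠ 1 := fun h => by simp [h] at hs
  obtain ⟨C, hC0, hC⟩ := exists_norm_quadForm_cpow_le hre s
  have hb : Summable fun j : {j : Fin 2 → ℤ // j ≠ 0} => C * ‖(j : Fin 2 → ℤ)‖ ^ (-(2 * s.re)) :=
    ((EisensteinSeries.summable_one_div_norm_rpow (k := 2 * s.re) (by linarith)).subtype _).mul_left C
  have hbd : ∀ j : {j : Fin 2 → ℤ // j ≠ 0}, ‖quadForm A (latticePt j) ^ (-s)‖ ≤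
      C * ‖(j : Fin 2 → ℤ)‖ ^ (-(2 * s.re)) := fun j => by
    have := hC _ (latticePt_ne_zero j.2)
    rwa [norm_latticePt] at this
  have hsum := (hb.of_norm_bounded hbd).hasSum
  suffices h : dyadicZeta A s = ∑' j : {j : Fin 2 → ℤ // j ≠ 0}, quadForm A (latticePt j) ^ (-s) by
    rw [h]
    exact hsum
  have hcut : ∀ (K : ℕ) (j : {j : Fin 2 → ℤ // j ≠ 0}),
      annularCutoff (2 ^ K) (latticePt j) = latticeBump (((2 : ℝ) ^ K)⁻¹ • latticePt j) :=
    fun K j => by rw [annularCutoff, latticeBump_latticePt j.2, sub_zero]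
  have hlim1 : Tendsto (fun K : ℕ => ∑' j : {j : Fin 2 → ℤ // j ≠ 0},
      annularPower A (2 ^ K) s (latticePt j)) atTop
      (𝓝 (∑' j : {j : Fin 2 → ℤ // j ≠ 0}, quadForm A (latticePt j) ^ (-s))) := by
    refine tendsto_tsum_of_dominated_convergence hb (fun j => ?_) (Eventually.of_forall fun K j => ?_)
    · refine tendsto_const_nhds.congr' ?_
      filter_upwards [tendsto_latticeBump (latticePt j)] with K hK
      rw [annularPower, hcut, hK, Complex.ofReal_one, one_mul]
    · rw [annularPower, hcut, norm_mul, Complex.norm_of_nonneg latticeBump.nonneg]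
      exact (mul_le_of_le_one_left (norm_nonneg _) latticeBump.le_one).trans (hbd j)
  -- Here Re(2 − 2s) < 0, so 2^(K(2−2s)) → 0 and β(s)(2^(K(2−2s)) − 1) → −β(s).
  have hlim2 : Tendsto (fun K : ℕ => annularIntegral A (2 ^ K) s) atTop (𝓝 (-bumpIntegral A s)) := by
    have h0 : Tendsto (fun K : ℕ => (((2 : ℝ) ^ K : ℝ) : ℂ) ^ (2 - 2 * s)) atTop (𝓝 0) := by
      rw [tendsto_zero_iff_norm_tendsto_zero]
      simp_rw [norm_two_pow_cpow]
      refine tendsto_pow_atTop_nhds_zero_of_lt_one (by positivity) ?_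
      exact Real.rpow_lt_one_of_one_lt_of_neg one_lt_two (by simp; linarith)
    have := (h0.sub_const 1).const_mul (bumpIntegral A s)
    simp only [zero_sub, mul_neg, mul_one] at this
    refine this.congr fun K => ?_
    rw [annularIntegral_eq_bumpIntegral_mul hre hs1 (one_le_pow₀ one_le_two)]
  have hlim := (hasSum_two_pow_cpow_mul_trapezoidError hre (s := s)).tendsto_sum_nat
  have hpart : ∀ K : ℕ, ∑ k ∈ Finset.range K, (((2 : ℝ) ^ k : ℝ) : ℂ) ^ (2 - 2 * s) *
      trapezoidError (annularPower A 2 s) ((2 : ℝ) ^ k)⁻¹ =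
      ∑' j : {j : Fin 2 → ℤ // j ≠ 0}, annularPower A (2 ^ K) s (latticePt j) -
        annularIntegral A (2 ^ K) s := by
    intro K
    have h := trapezoidError_annularPower_two_pow hre s (continuous_const (y := (1 : ℂ))) K
    simp only [mul_one] at h
    rw [← h, trapezoidError, annularIntegral]
    simp only [one_smul, Complex.ofReal_one, one_pow, one_mul]
    rw [← tsum_subtype_ne_zero (f := fun j => annularPower A (2 ^ K) s (latticePt j))]
    rw [latticePt_zero, annularPower,
      annularCutoff_eq_zero_of_norm_le (one_le_pow₀ one_le_two) (by simp)]
    simp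
  simp_rw [hpart] at hlim
  have := tendsto_nhds_unique hlim (hlim1.sub hlim2)
  rw [sub_neg_eq_add] at this
  exact add_right_cancel this

end PosDef

/-! ### The punctured error: dyadic series and second-order cancellation -/

/-- The error of the punctured trapezoidal rule with step `1` for the integral of
`G * Q_A ^ (-s)`. -/
noncomputable def puncturedError (A : Matrix (Fin 2) (Fin 2) ℂ) (s : ℝ) (G : (Fin 2 → ℝ) → ℂ) : ℂ :=
  ∑' j : {j : Fin 2 → ℤ // j ≠ 0}, G (latticePt j) * quadForm A (latticePt j) ^ (-(s : ℂ)) -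
    ∫ v, G v * quadForm A v ^ (-(s : ℂ))

theorem exists_norm_fderiv_le_and_norm_le {u : (Fin 2 → ℝ) → ℂ} (hu : ContDiff ℝ ∞ u) (h0 : u 0 = 0)
    (h1 : fderiv ℝ u 0 = 0) (ρ : ℝ) : ∃ D : ℝ, 0 ≤ D ∧ ∀ v, ‖v‖ ≤ ρ →
      ‖fderiv ℝ u v‖ ≤ D * ‖v‖ ∧ ‖u v‖ ≤ D * ‖v‖ ^ 2 := by
  have hu1 : ContDiff ℝ 1 (fderiv ℝ u) := hu.fderiv_right (by norm_cast)
  have hc : Continuous (fderiv ℝ (fderiv ℝ u)) := hu1.continuous_fderiv one_ne_zero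
  obtain ⟨D, hD⟩ := (isCompact_closedBall (0 : Fin 2 → ℝ) ρ).exists_bound_of_continuousOn
    (f := fderiv ℝ (fderiv ℝ u)) hc.continuousOn
  have key : ∀ v, ‖v‖ ≤ ρ → ‖fderiv ℝ u v‖ ≤ |D| * ‖v‖ := by
    intro v hv
    have := (convex_closedBall (0 : Fin 2 → ℝ) ρ).norm_image_sub_le_of_norm_fderiv_le
      (𝕜 := ℝ) (f := fderiv ℝ u) (x := 0) (y := v) (C := |D|)
      (fun x _ => (hu1.differentiable one_ne_zero) x)
      (fun x hx => (hD x hx).trans (le_abs_self D))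
      (Metric.mem_closedBall_self ((norm_nonneg v).trans hv)) (by simpa using hv)
    simpa [h1] using this
  refine ⟨|D|, abs_nonneg _, fun v hv => ⟨key v hv, ?_⟩⟩
  have := (convex_closedBall (0 : Fin 2 → ℝ) ‖v‖).norm_image_sub_le_of_norm_fderiv_le
    (𝕜 := ℝ) (f := u) (x := 0) (y := v) (C := |D| * ‖v‖)
    (fun x _ => (hu.differentiable (by simp)) x)
    (fun x hx => by
      rw [mem_closedBall_zero_iff] at hx
      exact (key x (hx.trans hv)).trans (by gcongr))
    (Metric.mem_closedBall_self (norm_nonneg v)) (by simp)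
  rw [h0, sub_zero, sub_zero] at this
  linarith [this.trans_eq (mul_assoc _ _ _), pow_two ‖v‖, congrArg (|D| * ·) (pow_two ‖v‖)]

section PosDef

variable {A : Matrix (Fin 2) (Fin 2) ℂ} (hre : (A.map Complex.re).PosDef)
include hre

theorem hasSum_trapezoidError_annularPower_mul {s : ℝ} (hs : s < 1) {G : (Fin 2 → ℝ) → ℂ}
    (hG : Continuous G) (hc : HasCompactSupport G) :
    HasSum (fun k : ℕ => (((2 : ℝ) ^ k : ℝ) : ℂ) ^ (2 - 2 * (s : ℂ)) *
        trapezoidError (fun v => annularPower A 2 s v * G ((2 : ℝ) ^ k • v)) ((2 : ℝ) ^ k)⁻¹)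
      (puncturedError A s G +
        ∫ v, (latticeBump v : ℂ) * G v * quadForm A v ^ (-(s : ℂ))) := by
  obtain ⟨R, hR⟩ := hc.isCompact.isBounded.subset_closedBall 0
  have hev : ∃ K₀ : ℕ, ∀ K ≥ K₀, 4 * R ≤ (2 : ℝ) ^ K := eventually_atTop.1
    ((tendsto_pow_atTop_atTop_of_one_lt (one_lt_two (α := ℝ))).eventually_ge_atTop (4 * R))
  obtain ⟨K₀, hK₀⟩ := hev
  have hint := integrable_mul_quadForm_cpow hre hG hc hs
  have hBc : Continuous fun v => (latticeBump v : ℂ) * G v :=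
    (Complex.continuous_ofReal.comp latticeBump.continuous).mul hG
  have hint2 := integrable_mul_quadForm_cpow hre hBc hc.mul_left hs
  have hpart : ∀ K ≥ K₀, ∑ k ∈ Finset.range K, (((2 : ℝ) ^ k : ℝ) : ℂ) ^ (2 - 2 * (s : ℂ)) *
        trapezoidError (fun v => annularPower A 2 s v * G ((2 : ℝ) ^ k • v)) ((2 : ℝ) ^ k)⁻¹ =
      puncturedError A s G + ∫ v, (latticeBump v : ℂ) * G v * quadForm A v ^ (-(s : ℂ)) := by
    intro K hK
    have hF : ∀ v, annularPower A (2 ^ K) s v * G v = G v * quadForm A v ^ (-(s : ℂ)) -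
        (latticeBump v : ℂ) * G v * quadForm A v ^ (-(s : ℂ)) := by
      intro v
      by_cases hv : ‖v‖ ≤ R
      · have : latticeBump (((2 : ℝ) ^ K)⁻¹ • v) = 1 := by
          refine latticeBump_eq_one ?_
          rw [norm_smul, norm_inv, Real.norm_of_nonneg (by positivity), ← div_eq_inv_mul,
            div_le_iff₀ (by positivity)]
          linarith [hK₀ K hK]
        rw [annularPower, annularCutoff, this]
        push_cast; ring
      · rw [image_eq_zero_of_notMem_tsupport (f := G) fun h => hv (by simpa using hR h)]
        simp
    rw [← trapezoidError_annularPower_two_pow hre s hG K, trapezoidError]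
    have h0 : annularPower A (2 ^ K) s ((1 : ℝ) • latticePt 0) *
        G ((1 : ℝ) • latticePt 0) = 0 := by
      rw [latticePt_zero, annularPower,
        annularCutoff_eq_zero_of_norm_le (one_le_pow₀ one_le_two) (by simp)]
      simp
    rw [← tsum_subtype_ne_zero (f := fun j => annularPower A (2 ^ K) s ((1 : ℝ) • latticePt j) *
        G ((1 : ℝ) • latticePt j)) h0]
    simp_rw [hF, one_smul]
    rw [integral_sub hint hint2, puncturedError, Complex.ofReal_one, one_pow, one_mul]
    have h1 : ∀ j : {j : Fin 2 → ℤ // j ≠ 0}, latticeBump (latticePt j) = 0 := fun j =>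
      latticeBump_latticePt j.2
    simp_rw [h1, Complex.ofReal_zero, zero_mul, sub_zero]
    ring
  rw [← hpart K₀ le_rfl]
  -- Once 2^K ≥ 4R the outer bump is 1 on the support of G, so partial sums are constant and all
  -- later terms vanish.
  refine hasSum_sum_of_ne_finset_zero fun k hk => ?_
  have hk' : K₀ ≤ k := by simpa using hk
  have := hpart (k + 1) (by omega)
  rw [Finset.sum_range_succ, hpart k hk'] at this
  exact left_eq_add.1 this.symm

/-- The gain r² must be uniform over all scales r. For r ≤ 4R, derivatives of u(r·) of order at
least 2 carry r² by the chain rule, and those of order 0 and 1 by Taylor's formula; the Leibniz rule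
combines them with the annular power. -/
theorem exists_norm_iteratedFDeriv_annularPower_mul_le (s : ℂ) {u : (Fin 2 → ℝ) → ℂ}
    (hu : ContDiff ℝ ∞ u) (h0 : u 0 = 0) (h1 : fderiv ℝ u 0 = 0) {R : ℝ} (hR1 : 1 ≤ R) {c : ℂ}
    (hR : ∀ v, R < ‖v‖ → u v = c) (M : ℕ) : ∃ B : ℝ, 0 ≤ B ∧ ∀ r : ℝ, 0 < r → ∀ v,
      ‖iteratedFDeriv ℝ M (fun v => annularPower A 2 s v * u (r • v)) v‖ ≤ B * r ^ 2 := by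
  choose P hP0 hP using fun m => exists_norm_iteratedFDeriv_annularPower_le hre one_le_two m ‖s‖
  obtain ⟨D, hD0, hD⟩ := exists_norm_fderiv_le_and_norm_le hu h0 h1 (4 * R)
  have hcomp : ∀ m : ℕ, ∃ E : ℝ, 0 ≤ E ∧ ∀ v, ‖v‖ ≤ 4 * R → ‖iteratedFDeriv ℝ m u v‖ ≤ E := by
    intro m
    have hc : Continuous (iteratedFDeriv ℝ m u) :=
      hu.continuous_iteratedFDeriv (by exact_mod_cast le_top)
    obtain ⟨E, hE⟩ := (isCompact_closedBall (0 : Fin 2 → ℝ) (4 * R)).exists_bound_of_continuousOn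
      hc.continuousOn
    exact ⟨|E|, abs_nonneg _, fun v hv => (hE v (by simpa using hv)).trans (le_abs_self _)⟩
  choose E hE0 hE using hcomp
  have hscaled : ∀ m : ℕ, ∃ E' : ℝ, 0 ≤ E' ∧ ∀ r : ℝ, 0 < r → r ≤ 4 * R → ∀ v : Fin 2 → ℝ,
      ‖v‖ ≤ 1 → ‖iteratedFDeriv ℝ m (fun v => u (r • v)) v‖ ≤ E' * r ^ 2 := by
    intro m
    have hb : ∀ r : ℝ, 0 < r → ∀ v : Fin 2 → ℝ, ‖iteratedFDeriv ℝ m (fun v => u (r • v)) v‖ ≤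
        ‖iteratedFDeriv ℝ m u (r • v)‖ * r ^ m := by
      intro r hr v
      have := norm_iteratedFDeriv_comp_affine_le hu m 0
        (r • ContinuousLinearMap.id ℝ (Fin 2 → ℝ)) v
      simp only [zero_add, smul_apply, ContinuousLinearMap.id_apply] at this
      refine this.trans ?_
      gcongr
      rw [norm_smul, Real.norm_of_nonneg hr.le]
      exact mul_le_of_le_one_right hr.le ContinuousLinearMap.norm_id_le
    have hrv : ∀ r : ℝ, 0 < r → ∀ v : Fin 2 → ℝ, ‖v‖ ≤ 1 → ‖r • v‖ ≤ r := by
      intro r hr v hv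
      rw [norm_smul, Real.norm_of_nonneg hr.le]
      exact mul_le_of_le_one_right hr.le hv
    match m with
    | 0 =>
      refine ⟨D, hD0, fun r hr hrR v hv => (hb r hr v).trans ?_⟩
      rw [norm_iteratedFDeriv_zero, pow_zero, mul_one]
      refine ((hD _ ((hrv r hr v hv).trans hrR)).2).trans ?_
      gcongr
      exact hrv r hr v hv
    | 1 =>
      refine ⟨D, hD0, fun r hr hrR v hv => (hb r hr v).trans ?_⟩
      rw [norm_iteratedFDeriv_one, pow_one, pow_two, ← mul_assoc]
      gcongr
      refine ((hD _ ((hrv r hr v hv).trans hrR)).1).trans ?_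
      gcongr
      exact hrv r hr v hv
    | m + 2 =>
      refine ⟨E (m + 2) * (4 * R) ^ m, mul_nonneg (hE0 _) (by positivity),
        fun r hr hrR v hv => (hb r hr v).trans ?_⟩
      rw [pow_add, ← mul_assoc]
      have := hE (m + 2) _ ((hrv r hr v hv).trans hrR)
      have := hE0 (m + 2)
      gcongr
  choose E' hE'0 hE' using hscaled
  have hsum0 : 0 ≤ ∑ i ∈ Finset.range (M + 1), (M.choose i : ℝ) * P i * E' (M - i) :=
    Finset.sum_nonneg fun i _ => mul_nonneg (mul_nonneg (Nat.cast_nonneg _) (hP0 i)) (hE'0 _)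
  refine ⟨(∑ i ∈ Finset.range (M + 1), (M.choose i : ℝ) * P i * E' (M - i)) + P M * ‖c‖,
    add_nonneg hsum0 (mul_nonneg (hP0 M) (norm_nonneg _)), fun r hr v => ?_⟩
  have hΨ := contDiff_annularPower hre one_le_two s
  rw [add_mul]
  rcases le_or_gt r (4 * R) with hrR | hrR
  · refine le_add_of_le_of_nonneg ?_ (mul_nonneg (mul_nonneg (hP0 M) (norm_nonneg _)) (sq_nonneg r))
    by_cases hv : 1 < ‖v‖
    · rw [iteratedFDeriv_eq_zero_of_norm_lt (R := 1) (fun v hv => ?_) M hv, norm_zero]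
      · positivity
      · rw [annularPower_eq_zero one_le_two (by linarith), zero_mul]
    · have hur : ContDiff ℝ ∞ fun v => u (r • v) := hu.comp (contDiff_const_smul r)
      refine (norm_iteratedFDeriv_mul_le hΨ hur v (by exact_mod_cast le_top)).trans ?_
      rw [Finset.sum_mul]
      refine Finset.sum_le_sum fun i _ => ?_
      rw [mul_assoc ((M.choose i : ℝ) * P i)]
      have h2 := hP i s le_rfl v
      have h3 := hE' (M - i) r hr hrR v (not_lt.1 hv)
      have h4 := hP0 i
      gcongr
  -- For r > 4R, the cutoff restricts to ‖v‖ > 1/4, where ‖rv‖ > R and u(rv) = c; the remaining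
  -- bound is constant and r² ≥ 1.
  · refine le_add_of_nonneg_of_le (by positivity) ?_
    have hconst : (fun v => annularPower A 2 s v * u (r • v)) = c • annularPower A 2 s := by
      ext v
      rw [Pi.smul_apply, smul_eq_mul, mul_comm c]
      by_cases hv : ‖v‖ ≤ 1 / 4
      · simp [annularPower, annularCutoff_eq_zero_of_norm_le one_le_two hv]
      · rw [hR]
        rw [norm_smul, Real.norm_of_nonneg hr.le]
        nlinarith
    rw [hconst, iteratedFDeriv_const_smul_apply (hΨ.of_le (by exact_mod_cast le_top)).contDiffAt, norm_smul,
      mul_comm ‖c‖, mul_assoc]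
    have h2 := hP M s le_rfl v
    have h3 : 1 ≤ r ^ 2 := one_le_pow₀ (by linarith)
    refine mul_le_mul h2 (le_mul_of_one_le_right (norm_nonneg _) h3) (norm_nonneg _) (hP0 M)

end PosDef

theorem fderiv_zero_of_even {g : (Fin 2 → ℝ) → ℂ} (hg : ∀ v, g (-v) = g v) : fderiv ℝ g 0 = 0 := by
  have h := fderiv_comp_smul (𝕜 := ℝ) (f := g) (c := (-1 : ℝ)) (x := 0)
  simp only [neg_smul, one_smul, hg, neg_zero] at h
  ext1 v
  exact self_eq_neg.1 (DFunLike.congr_fun h v)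

theorem hasCompactSupport_comp_smul {g : (Fin 2 → ℝ) → ℂ} (hc : HasCompactSupport g) {h : ℝ}
    (hh : 0 < h) : HasCompactSupport fun v => g (h • v) :=
  hc.comp_homeomorph (Homeomorph.smulOfNeZero h hh.ne')

section PosDef

variable {A : Matrix (Fin 2) (Fin 2) ℂ} (hre : (A.map Complex.re).PosDef)
include hre

theorem exists_norm_two_pow_cpow_mul_trapezoidError_mul_le (s : ℝ) (hs : s < 1)
    {u : (Fin 2 → ℝ) → ℂ} (hu : ContDiff ℝ ∞ u) (h0 : u 0 = 0) (h1 : fderiv ℝ u 0 = 0) {R : ℝ}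
    (hR1 : 1 ≤ R) {c : ℂ} (hR : ∀ v, R < ‖v‖ → u v = c) :
    ∃ C : ℝ, 0 ≤ C ∧ ∀ h : ℝ, 0 < h → ∀ k : ℕ, ‖(((2 : ℝ) ^ k : ℝ) : ℂ) ^ (2 - 2 * (s : ℂ)) *
      trapezoidError (fun v => annularPower A 2 s v * u (h • (2 : ℝ) ^ k • v)) ((2 : ℝ) ^ k)⁻¹‖ ≤
        C * h ^ 2 * (1 / 2) ^ k := by
  -- The factors 2^(k(2−2s)) and (2^k)² grow together like 2^(k(4−2s)).
  set N : ℕ := ⌈4 - 2 * s⌉₊ with hN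
  have hN2 : 4 - 2 * s ≤ N := Nat.le_ceil _
  have hN1 : 1 ≤ N := by
    have : (0 : ℝ) < N := by linarith
    exact_mod_cast this
  obtain ⟨B, hB0, hB⟩ := exists_norm_iteratedFDeriv_annularPower_mul_le hre s hu h0 h1 hR1 hR (N + 1)
  obtain ⟨C, hC0, hC⟩ := exists_norm_trapezoidError_le (N + 1) (by omega) 1
  refine ⟨C * B, by positivity, fun h hh k => ?_⟩
  have h2k : (1 : ℝ) ≤ 2 ^ k := one_le_pow₀ one_le_two
  have hr : 0 < h * 2 ^ k := by positivity
  have e1 := hC _ ((contDiff_annularPower hre one_le_two s).mul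
    (hu.comp (contDiff_const_smul (h * 2 ^ k)))) (fun v hv => by
      rw [annularPower_eq_zero one_le_two (by linarith), zero_mul])
    _ (hB (h * 2 ^ k) hr) ((2 : ℝ) ^ k)⁻¹ (by positivity) (inv_le_one_of_one_le₀ h2k)
  have e2 : (2 : ℝ) ^ (2 - 2 * (s : ℂ)).re * 2 ^ 2 ≤ 2 ^ N := by
    rw [← Real.rpow_natCast, ← Real.rpow_natCast, ← Real.rpow_add two_pos]
    refine Real.rpow_le_rpow_of_exponent_le one_le_two ?_
    simp
    linarith
  simp_rw [smul_smul]
  rw [norm_mul, norm_two_pow_cpow]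
  calc _ ≤ ((2 : ℝ) ^ (2 - 2 * (s : ℂ)).re) ^ k *
        (C * (B * (h * 2 ^ k) ^ 2) * ((2 : ℝ) ^ k)⁻¹ ^ (N + 1)) := by gcongr; exact e1
    _ = ((2 : ℝ) ^ (2 - 2 * (s : ℂ)).re * 2 ^ 2) ^ k *
        (C * B * h ^ 2 * ((2 : ℝ) ^ k)⁻¹ ^ (N + 1)) := by
      rw [mul_pow _ ((2 : ℝ) ^ 2) k, ← pow_mul, mul_comm 2 k, pow_mul]
      ring
    _ ≤ (2 ^ N) ^ k * (C * B * h ^ 2 * ((2 : ℝ) ^ k)⁻¹ ^ (N + 1)) := by gcongr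
    _ = C * B * h ^ 2 * (1 / 2) ^ k := by
      have e3 : ((2 : ℝ) ^ k)⁻¹ ^ (N + 1) = ((2 ^ N) ^ k)⁻¹ * (1 / 2) ^ k := by
        rw [pow_succ, inv_pow, ← pow_mul, ← pow_mul, mul_comm N k, one_div, inv_pow]
      rw [e3]
      field_simp

theorem exists_norm_puncturedError_sub_le_of_even {s : ℝ} (hs : s < 1) {g : (Fin 2 → ℝ) → ℂ}
    (hg : ContDiff ℝ ∞ g) (hc : HasCompactSupport g) (heven : ∀ v, g (-v) = g v) :
    ∃ C : ℝ, ∀ h : ℝ, 0 < h → h ≤ 1 →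
      ‖puncturedError A s (fun v => g (h • v)) - dyadicZeta A s * g 0‖ ≤ C * h ^ 2 := by
  obtain ⟨R, hR⟩ := hc.isCompact.isBounded.subset_closedBall 0
  set u : (Fin 2 → ℝ) → ℂ := fun v => g v - g 0 with hu
  have hus : ContDiff ℝ ∞ u := hg.sub contDiff_const
  have hu0 : u 0 = 0 := sub_self _
  have hu1 : fderiv ℝ u 0 = 0 := fderiv_zero_of_even fun v => by simp [hu, heven]
  have huR : ∀ v, max 1 R < ‖v‖ → u v = -g 0 := fun v hv => by
    have hv' : v ∉ tsupport g := fun h => by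
      have := hR h
      rw [mem_closedBall_zero_iff] at this
      linarith [le_max_right 1 R]
    simp [hu, image_eq_zero_of_notMem_tsupport hv']
  obtain ⟨C, hC0, hC⟩ := exists_norm_two_pow_cpow_mul_trapezoidError_mul_le hre s hs hus hu0 hu1
    (le_max_left 1 R) huR
  obtain ⟨D, hD0, hD⟩ := exists_norm_fderiv_le_and_norm_le hus hu0 hu1 1
  have hBc : Continuous fun v => (latticeBump v : ℂ) :=
    Complex.continuous_ofReal.comp latticeBump.continuous
  have hBs : HasCompactSupport fun v => (latticeBump v : ℂ) :=
    latticeBump.hasCompactSupport.comp_left Complex.ofReal_zero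
  have hBint := integrable_mul_quadForm_cpow hre hBc hBs hs
  set J : ℝ := ∫ v, ‖(latticeBump v : ℂ) * quadForm A v ^ (-(s : ℂ))‖ with hJ
  -- The factor 2 sums the series of (1/2)^k; D·J bounds the bump integral of u(h·) through ‖u(v)‖ ≤
  -- D‖v‖².
  refine ⟨C * 2 + D * J, fun h hh hh1 => ?_⟩
  set G : (Fin 2 → ℝ) → ℂ := fun v => g (h • v) with hGdef
  have hG : ContDiff ℝ ∞ G := hg.comp (contDiff_const_smul h)
  have hGs : HasCompactSupport G := hasCompactSupport_comp_smul hc hh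
  have hsum1 := hasSum_trapezoidError_annularPower_mul hre hs hG.continuous hGs
  have hsum2 := (hasSum_two_pow_cpow_mul_trapezoidError hre (s := s)).mul_left (g 0)
  have hterm : ∀ k : ℕ, (((2 : ℝ) ^ k : ℝ) : ℂ) ^ (2 - 2 * (s : ℂ)) *
      trapezoidError (fun v => annularPower A 2 s v * G ((2 : ℝ) ^ k • v)) ((2 : ℝ) ^ k)⁻¹ -
      g 0 * ((((2 : ℝ) ^ k : ℝ) : ℂ) ^ (2 - 2 * (s : ℂ)) *
        trapezoidError (annularPower A 2 s) ((2 : ℝ) ^ k)⁻¹) =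
      (((2 : ℝ) ^ k : ℝ) : ℂ) ^ (2 - 2 * (s : ℂ)) *
      trapezoidError (fun v => annularPower A 2 s v * u (h • (2 : ℝ) ^ k • v)) ((2 : ℝ) ^ k)⁻¹ := by
    intro k
    have e1 : (fun v => annularPower A 2 s v * G ((2 : ℝ) ^ k • v)) = fun v =>
        annularPower A 2 s v * u (h • (2 : ℝ) ^ k • v) + g 0 * annularPower A 2 s v := by
      ext v
      simp only [hu, hGdef]
      ring
    have hΨ := (contDiff_annularPower hre one_le_two s).continuous
    have hz : ∀ v : Fin 2 → ℝ, 1 < ‖v‖ → annularPower A 2 s v = 0 := fun v hv =>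
      annularPower_eq_zero one_le_two (by linarith)
    rw [e1, trapezoidError_add (F := fun v => annularPower A 2 s v * u (h • (2 : ℝ) ^ k • v))
      (G := fun v => g 0 * annularPower A 2 s v) (R := 1)
      (hΨ.mul (hus.continuous.comp ((continuous_const_smul h).comp (continuous_const_smul _))))
      (continuous_const.mul hΨ) (fun v hv => by rw [hz v hv, zero_mul])
      (fun v hv => by rw [hz v hv, mul_zero]) (by positivity), trapezoidError_const_mul]
    ring
  have hdiff := hsum1.sub hsum2
  simp_rw [hterm] at hdiff
  have hle : ‖puncturedError A s G + (∫ v, (latticeBump v : ℂ) * G v * quadForm A v ^ (-(s : ℂ))) -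
      g 0 * (dyadicZeta A s + bumpIntegral A s)‖ ≤ C * h ^ 2 * 2 := by
    rw [← hdiff.tsum_eq]
    exact tsum_of_norm_bounded (hasSum_geometric_two.mul_left (C * h ^ 2)) (hC h hh)
  have hGB : Integrable fun v => (latticeBump v : ℂ) * G v * quadForm A v ^ (-(s : ℂ)) :=
    integrable_mul_quadForm_cpow hre (hBc.mul hG.continuous) (hBs.mul_right (f' := G)) hs
  have hint : ‖(∫ v, (latticeBump v : ℂ) * G v * quadForm A v ^ (-(s : ℂ))) -
      g 0 * bumpIntegral A s‖ ≤ D * h ^ 2 * J := by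
    rw [← integral_latticeBump_mul hre hs, ← integral_const_mul, ← integral_sub hGB
      (hBint.const_mul _), hJ, ← integral_const_mul]
    refine norm_integral_le_of_norm_le (hBint.norm.const_mul _) (Eventually.of_forall fun v => ?_)
    have e1 : (latticeBump v : ℂ) * G v * quadForm A v ^ (-(s : ℂ)) -
        g 0 * ((latticeBump v : ℂ) * quadForm A v ^ (-(s : ℂ))) =
        u (h • v) * ((latticeBump v : ℂ) * quadForm A v ^ (-(s : ℂ))) := by
      simp only [hu, hGdef]
      ring
    rw [e1, norm_mul]
    by_cases hv : 1 / 2 ≤ ‖v‖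
    · simp [latticeBump_eq_zero hv]
    · have hhv : ‖h • v‖ ≤ h := by
        rw [norm_smul, Real.norm_of_nonneg hh.le]
        exact mul_le_of_le_one_right hh.le (by linarith)
      refine mul_le_mul_of_nonneg_right ((hD _ (hhv.trans hh1)).2.trans ?_) (norm_nonneg _)
      gcongr
  have : puncturedError A s G - dyadicZeta A s * g 0 =
      (puncturedError A s G + (∫ v, (latticeBump v : ℂ) * G v * quadForm A v ^ (-(s : ℂ))) -
        g 0 * (dyadicZeta A s + bumpIntegral A s)) -
      ((∫ v, (latticeBump v : ℂ) * G v * quadForm A v ^ (-(s : ℂ))) - g 0 * bumpIntegral A s) := by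
    ring
  rw [this]
  refine (norm_sub_le _ _).trans ((add_le_add hle hint).trans_eq ?_)
  ring

/-- Both the punctured lattice and Q are invariant under v ↦ −v, so only the even part of G
contributes. -/
theorem puncturedError_symmetrize {s : ℝ} (hs : s < 1) {G : (Fin 2 → ℝ) → ℂ} (hG : Continuous G)
    (hc : HasCompactSupport G) :
    puncturedError A s (fun v => (1 / 2 : ℂ) * (G v + G (-v))) = puncturedError A s G := by
  have hint := integrable_mul_quadForm_cpow hre hG hc hs
  have hint' : Integrable fun v => G (-v) * quadForm A v ^ (-(s : ℂ)) := by
    simpa [quadForm_neg] using hint.comp_neg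
  have hI : ∫ v, G (-v) * quadForm A v ^ (-(s : ℂ)) = ∫ v, G v * quadForm A v ^ (-(s : ℂ)) := by
    rw [← integral_neg_eq_self]
    simp [quadForm_neg]
  set T : {j : Fin 2 → ℤ // j ≠ 0} → ℂ := fun j =>
    G (latticePt j) * quadForm A (latticePt j) ^ (-(s : ℂ)) with hT
  let e : {j : Fin 2 → ℤ // j ≠ 0} ≃ {j : Fin 2 → ℤ // j ≠ 0} :=
    (Equiv.neg (Fin 2 → ℤ)).subtypeEquiv fun j => by simp
  have he : ∀ j, T (e j) = G (-latticePt j) * quadForm A (latticePt j) ^ (-(s : ℂ)) := by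
    intro j
    have : latticePt (e j : Fin 2 → ℤ) = -latticePt j := by
      ext i; simp [latticePt, e]
    rw [hT]
    simp only [this, quadForm_neg]
  have hsum : Summable T := by
    obtain ⟨R, hR⟩ := hc.isCompact.isBounded.subset_closedBall 0
    have hfin : (Function.support fun j : Fin 2 → ℤ =>
        G (latticePt j) * quadForm A (latticePt j) ^ (-(s : ℂ))).Finite := by
      have := support_smul_latticePt_finite
        (F := fun v => G v * quadForm A v ^ (-(s : ℂ))) (R := R) (fun v hv => by
          rw [image_eq_zero_of_notMem_tsupport (f := G) fun h => by
            have := hR h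
            rw [mem_closedBall_zero_iff] at this
            linarith, zero_mul]) one_pos
      simpa using this
    exact (summable_of_hasFiniteSupport hfin).subtype _
  have hS : ∑' j, T (e j) = ∑' j, T j := e.tsum_eq T
  simp only [puncturedError, mul_assoc, add_mul, integral_const_mul, tsum_mul_left]
  have hadd : ∑' j, (T j + T (e j)) = ∑' j, T j + ∑' j, T (e j) :=
    Summable.tsum_add hsum (e.summable_iff.2 hsum)
  simp_rw [← he]
  rw [integral_add hint hint', hI, hadd, hS]
  ring

theorem exists_norm_puncturedError_sub_le {s : ℝ} (hs : s < 1) {g : (Fin 2 → ℝ) → ℂ}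
    (hg : ContDiff ℝ ∞ g) (hc : HasCompactSupport g) :
    ∃ C : ℝ, ∀ h : ℝ, 0 < h → h ≤ 1 →
      ‖puncturedError A s (fun v => g (h • v)) - dyadicZeta A s * g 0‖ ≤ C * h ^ 2 := by
  have hcn : HasCompactSupport fun v => g (-v) :=
    hc.comp_homeomorph (Homeomorph.neg (Fin 2 → ℝ))
  obtain ⟨C, hC⟩ := exists_norm_puncturedError_sub_le_of_even hre hs
    (g := fun v => (1 / 2 : ℂ) * (g v + g (-v)))
    (contDiff_const.mul (hg.add (hg.comp contDiff_neg))) ((hc.add hcn).mul_left)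
    (fun v => by rw [neg_neg, add_comm])
  refine ⟨C, fun h hh hh1 => ?_⟩
  have := hC h hh hh1
  have e := puncturedError_symmetrize hre hs (G := fun v => g (h • v))
    (hg.continuous.comp (continuous_const_smul h)) (hasCompactSupport_comp_smul hc hh)
  simp only [smul_neg] at e
  simp only [e, neg_zero] at this
  convert this using 4
  ring

end PosDef

/-! ### Rescaling to step one and conclusion -/

theorem puncturedTrapezoidal_sub_singularIntegral (A : Matrix (Fin 2) (Fin 2) ℂ)
    (g : (Fin 2 → ℝ) → ℂ) (s : ℝ) {h : ℝ} (hh : 0 < h) :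
    puncturedTrapezoidal A g s h - singularIntegral A g s =
      ((h ^ (2 - 2 * s) : ℝ) : ℂ) * puncturedError A s fun v => g (h • v) := by
  have hI : singularIntegral A g s = ((h ^ (2 - 2 * s) : ℝ) : ℂ) *
      ∫ v, g (h • v) * quadForm A v ^ (-(s : ℂ)) := by
    have hh' : (h : ℂ) ≠ 0 := by exact_mod_cast hh.ne'
    have h1 := Measure.integral_comp_smul_of_nonneg volume
      (fun v => g v * quadForm A v ^ (-(s : ℂ))) h (hR := hh.le)
    have h2 : ∀ v, quadForm A (h • v) ^ (-(s : ℂ)) =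
        ((h ^ (-(2 * s)) : ℝ) : ℂ) * quadForm A v ^ (-(s : ℂ)) := fun v => by
      rw [quadForm_smul_cpow A hh, Complex.ofReal_cpow hh.le]
      push_cast; ring_nf
    simp_rw [h2, mul_left_comm (g _)] at h1
    rw [integral_const_mul, Module.finrank_fin_fun] at h1
    have h3 : ((h ^ (2 - 2 * s) : ℝ) : ℂ) = (h : ℂ) ^ 2 * ((h ^ (-(2 * s)) : ℝ) : ℂ) := by
      rw [sub_eq_add_neg, Real.rpow_add hh]
      push_cast
      norm_num
    rw [h3, mul_assoc, h1, singularIntegral, Complex.real_smul]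
    simp only [div_eq_mul_inv, Complex.cpow_neg]
    push_cast
    field_simp
  rw [hI, puncturedError, puncturedTrapezoidal, tsum_mul_right]
  simp only [div_eq_mul_inv, Complex.cpow_neg]
  ring

theorem mainTheorem1 (A : Matrix (Fin 2) (Fin 2) ℂ) (hA : A.IsSymm)
    (hre : (A.map Complex.re).PosDef) (hinv : (A⁻¹.map Complex.re).PosDef) :
    IsEpsteinContinuation A (epsteinZeta A) ∧
    ∀ (g : (Fin 2 → ℝ) → ℂ), ContDiff ℝ ∞ g → HasCompactSupport g →
    ∀ s : ℝ, s < 1 →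
      Integrable (fun v : Fin 2 → ℝ => g v / quadForm A v ^ (s : ℂ)) ∧
      (fun h : ℝ => singularIntegral A g s -
          (puncturedTrapezoidal A g s h -
            epsteinZeta A (s : ℂ) * g 0 * ((h ^ (2 - 2 * s) : ℝ) : ℂ)))
        =O[𝓝[>] 0] (fun h : ℝ => h ^ (4 - 2 * s)) := by
  have hZ := isEpsteinContinuation_dyadicZeta hre
  refine ⟨?_, fun g hg hc s hs => ⟨?_, ?_⟩⟩
  · have h : ∃ Z, IsEpsteinContinuation A Z := ⟨_, hZ⟩
    rw [epsteinZeta, dif_pos h]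
    exact Classical.choose_spec h
  · simpa only [div_eq_mul_inv, Complex.cpow_neg] using
      integrable_mul_quadForm_cpow hre hg.continuous hc hs
  · have hs1 : (s : ℂ) ≠ 1 := by exact_mod_cast hs.ne
    rw [hZ.epsteinZeta_eq hs1]
    obtain ⟨C, hC⟩ := exists_norm_puncturedError_sub_le hre hs hg hc
    refine IsBigO.of_bound C ?_
    filter_upwards [Ioc_mem_nhdsGT (zero_lt_one (α := ℝ))] with h hh
    have hpos : 0 < h ^ (2 - 2 * s) := Real.rpow_pos_of_pos hh.1 _
    have e1 : singularIntegral A g s - (puncturedTrapezoidal A g s h -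
        dyadicZeta A s * g 0 * ((h ^ (2 - 2 * s) : ℝ) : ℂ)) =
        -(((h ^ (2 - 2 * s) : ℝ) : ℂ) *
          (puncturedError A s (fun v => g (h • v)) - dyadicZeta A s * g 0)) := by
      linear_combination -puncturedTrapezoidal_sub_singularIntegral A g s hh.1
    have e2 : h ^ (4 - 2 * s) = h ^ (2 - 2 * s) * h ^ 2 := by
      rw [← Real.rpow_natCast, ← Real.rpow_add hh.1]
      congr 1
      push_cast; ring
    rw [e1, norm_neg, norm_mul, Complex.norm_of_nonneg hpos.le, e2,
      Real.norm_of_nonneg (by have := hh.1; positivity)]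
    calc _ ≤ h ^ (2 - 2 * s) * (C * h ^ 2) :=
          mul_le_mul_of_nonneg_left (hC h hh.1 hh.2) hpos.le
      _ = C * (h ^ (2 - 2 * s) * h ^ 2) := by ring
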